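/- Let $L>0$ and $P=L+\pi$. Let $\Gamma$ be the periodic metric graph with edges $\Gamma_{n,0}=[nP,nP+L]$ (horizontal links) and $\Gamma_{n,+},\Gamma_{n,-}$, two copies of $[nP+L,(n+1)P]$ (the upper and lower semicircles of a circle of length $2\pi$), $n\in\mathbb Z$; the right end of $\Gamma_{n,0}$ is joined to the left ends of $\Gamma_{n,\pm}$, and the right ends of $\Gamma_{n,\pm}$ are joined to the left end of $\Gamma_{n+1,0}$. Let $-\partial_x^2$ be the operator in $L^2(\Gamma;\mathbb C)$ which acts as $-\partial_x^2$ on each edge, with domain $\mathcal D$ consisting of all $w\in H^2(\Gamma)$ (defined edge by edge, without conditions at the vertices, and with the norms on the edges square summable) such that, for all $n\in\mathbb Z$, $$w_{n,0}(nP+L)=w_{n,+}(nP+L)=w_{n,-}(nP+L),\qquad w_{n+1,0}((n+1)P)=w_{n,+}((n+1)P)=w_{n,-}((n+1)P),$$ $$\partial_xw_{n,0}(nP+L)=\partial_xw_{n,+}(nP+L)+\partial_xw_{n,-}(nP+L),$$ $$\partial_xw_{n+1,0}((n+1)P)=\partial_xw_{n,+}((n+1)P)+\partial_xw_{n,-}((n+1)P).$$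 Put $$T(\omega)=2\cos(\pi\omega)\cos(L\omega)-\tfrac52\sin(\pi\omega)\sin(L\omega),\qquad \omega\in\mathbb R.$$ Proposition. The eigenvalues of infinite multiplicity of $-\partial_x^2$ (those with an infinite-dimensional eigenspace) are exactly the numbers $m^2$, $m=1,2,3,\dots$. There is a sequence of compact intervals (spectral bands) $\sigma_k=[a_k,b_k]$, $k=0,1,2,\dots$, with $a_k<b_k\le a_{k+1}$ for all $k$, such that for every $k$ the map $\lambda\mapsto T(\sqrt\lambda)$ is a bijection of $\sigma_k$ onto $[-2,2]$, $$\bigcup_k\sigma_k=\{\omega^2:\ \omega\in\mathbb R,\ T(\omega)\in[-2,2]\},$$ and the spectrum of $-\partial_x^2$ (a subset of $\mathbb C$) is $$\sigma(-\partial_x^2)=\{m^2:\ m=1,2,3,\dots\}\ \cup\ \bigcup_k\sigma_k .$$ Moreover, $m^2\in\bigcup_k\sigma_k$ for every $m=1,2,3,\dots$. -/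

import Mathlib

open MeasureTheory Set Filter

noncomputable section

namespace PeriodicGraph

/-- The three kinds of edges in each cell of the graph `Γ`: the horizontal link and the upper and
lower semicircles. -/
inductive EdgeKind
  | link
  | upper
  | lower

/-- The edges `Γ_{n,0}`, `Γ_{n,+}`, `Γ_{n,-}` of `Γ`, `n ∈ ℤ`. -/
abbrev Edge : Type := ℤ × EdgeKind

/-- The length of an edge. The edge `e` is identified with `[0, edgeLength L e]`; the point with
local coordinate `x` is the point `n P + x` of the link `Γ_{n,0}`, respectively the point
`n P + L + x` of the semicircle `Γ_{n,±}`, where `P = L + π`. All edges are directed to the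
right. -/
def edgeLength (L : ℝ) (e : Edge) : ℝ :=
  match e.2 with
  | .link => L
  | .upper => Real.pi
  | .lower => Real.pi

/-- Lebesgue measure on an edge. -/
abbrev edgeMeasure (L : ℝ) (e : Edge) : Measure ℝ :=
  volume.restrict (Icc 0 (edgeLength L e))

/-- The Hilbert space `L²(Γ)` of complex-valued functions: the Hilbert sum of the spaces
`L²` over all edges. -/
abbrev L2Graph (L : ℝ) : Type :=
  lp (fun e : Edge => Lp ℂ 2 (edgeMeasure L e)) 2

/-- `u` is an absolutely continuous representative on `[0, ℓ]` of the class `f ∈ L²(0, ℓ)`, and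
`d ∈ L²(0, ℓ)` is its derivative: `u = f` almost everywhere and
`u x = u 0 + ∫₀ˣ d` on `[0, ℓ]`. In other words `f ∈ H¹(0, ℓ)`, `f' = d`, and `u` is the
continuous representative of `f`. -/
structure IsACRep (ℓ : ℝ) (u : ℝ → ℂ) (f d : Lp ℂ 2 (volume.restrict (Icc 0 ℓ))) : Prop where
  ae_eq : ⇑f =ᵐ[volume.restrict (Icc 0 ℓ)] u
  eq_integral : ∀ x ∈ Icc 0 ℓ, u x = u 0 + ∫ t in (0 : ℝ)..x, d t

/-- Continuity of `u` at all vertices of `Γ`. -/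
structure IsContinuousAtVertices (L : ℝ) (u : Edge → ℝ → ℂ) : Prop where
  left_upper : ∀ n : ℤ, u (n, .link) L = u (n, .upper) 0
  left_lower : ∀ n : ℤ, u (n, .link) L = u (n, .lower) 0
  right_upper : ∀ n : ℤ, u (n + 1, .link) 0 = u (n, .upper) Real.pi
  right_lower : ∀ n : ℤ, u (n + 1, .link) 0 = u (n, .lower) Real.pi

/-- The Kirchhoff conditions at all vertices of `Γ`, for the derivative `v` of a function
along the (rightwards directed) edges. -/
structure IsKirchhoff (L : ℝ) (v : Edge → ℝ → ℂ) : Prop where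
  left : ∀ n : ℤ, v (n, .link) L = v (n, .upper) 0 + v (n, .lower) 0
  right : ∀ n : ℤ, v (n + 1, .link) 0 = v (n, .upper) Real.pi + v (n, .lower) Real.pi

/-- `w` belongs to the domain `𝒟` of the Laplacian on `Γ` and `g = ∂ₓ² w`: there is
`w' ∈ L²(Γ)` such that, on each edge, `w` and `w'` have absolutely continuous representatives
`u` and `v`, with derivatives `w'` and `g` (so that `w ∈ H²(Γ)`), where `u` is continuous
at the vertices and `v` satisfies the Kirchhoff conditions. -/
def IsLaplacian (L : ℝ) (w g : L2Graph L) : Prop :=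
  ∃ (w' : L2Graph L) (u v : Edge → ℝ → ℂ),
    (∀ e, IsACRep (edgeLength L e) (u e) (w e) (w' e)) ∧
    (∀ e, IsACRep (edgeLength L e) (v e) (w' e) (g e)) ∧
    IsContinuousAtVertices L u ∧ IsKirchhoff L v

theorem intervalIntegrable_of_Lp {ℓ : ℝ} (d : Lp ℂ 2 (volume.restrict (Icc (0 : ℝ) ℓ))) {x : ℝ}
    (hx : x ∈ Icc 0 ℓ) : IntervalIntegrable d volume 0 x := by
  have h1 : Integrable d (volume.restrict (Icc (0 : ℝ) ℓ)) :=
    (Lp.memLp d).integrable (by norm_num)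
  rw [intervalIntegrable_iff_integrableOn_Icc_of_le hx.1]
  exact IntegrableOn.mono_set h1 (Icc_subset_Icc_right hx.2)

theorem integral_congr_Lp {ℓ x : ℝ} (hx : x ∈ Icc 0 ℓ) {f g : ℝ → ℂ}
    (h : f =ᵐ[volume.restrict (Icc (0 : ℝ) ℓ)] g) :
    ∫ t in (0 : ℝ)..x, f t = ∫ t in (0 : ℝ)..x, g t := by
  rw [intervalIntegral.integral_of_le hx.1, intervalIntegral.integral_of_le hx.1]
  refine integral_congr_ae (ae_restrict_of_ae_restrict_of_subset ?_ h)
  exact fun y hy => ⟨hy.1.le, hy.2.trans hx.2⟩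

theorem IsACRep.add {ℓ : ℝ} {u₁ u₂ : ℝ → ℂ} {f₁ f₂ d₁ d₂ : Lp ℂ 2 (volume.restrict (Icc 0 ℓ))}
    (h₁ : IsACRep ℓ u₁ f₁ d₁) (h₂ : IsACRep ℓ u₂ f₂ d₂) :
    IsACRep ℓ (u₁ + u₂) (f₁ + f₂) (d₁ + d₂) where
  ae_eq := (Lp.coeFn_add f₁ f₂).trans (h₁.ae_eq.add h₂.ae_eq)
  eq_integral x hx := by
    rw [integral_congr_Lp hx (Lp.coeFn_add d₁ d₂)]
    simp only [Pi.add_apply]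
    rw [intervalIntegral.integral_add (intervalIntegrable_of_Lp d₁ hx)
      (intervalIntegrable_of_Lp d₂ hx), h₁.eq_integral x hx, h₂.eq_integral x hx]
    ring

theorem IsACRep.smul {ℓ : ℝ} {u : ℝ → ℂ} {f d : Lp ℂ 2 (volume.restrict (Icc 0 ℓ))} (c : ℂ)
    (h : IsACRep ℓ u f d) : IsACRep ℓ (c • u) (c • f) (c • d) where
  ae_eq := (Lp.coeFn_smul c f).trans (h.ae_eq.const_smul c)
  eq_integral x hx := by
    rw [integral_congr_Lp hx (Lp.coeFn_smul c d)]
    simp only [Pi.smul_apply]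
    rw [intervalIntegral.integral_smul, h.eq_integral x hx, smul_add]

theorem IsACRep.zero (ℓ : ℝ) : IsACRep ℓ 0 0 0 where
  ae_eq := Lp.coeFn_zero _ _ _
  eq_integral x hx := by
    rw [integral_congr_Lp hx (Lp.coeFn_zero ℂ 2 (volume.restrict (Icc 0 ℓ)))]
    simp

theorem IsACRep.derivative_eq_zero {ℓ : ℝ} {u : ℝ → ℂ} {d : Lp ℂ 2 (volume.restrict (Icc 0 ℓ))}
    (h : IsACRep ℓ u 0 d) : d = 0 := by
  rw [Lp.eq_zero_iff_ae_eq_zero]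
  rcases le_or_gt ℓ 0 with hℓ | hℓ
  · have h0 : (volume.restrict (Icc (0 : ℝ) ℓ)) = 0 := by
      rw [Measure.restrict_eq_zero, Real.volume_Icc]
      simpa using hℓ
    have h1 : ae (volume.restrict (Icc (0 : ℝ) ℓ)) = ⊥ := ae_eq_bot.2 h0
    exact (h1 ▸ Filter.eventually_bot :
      ∀ᶠ x in ae (volume.restrict (Icc (0 : ℝ) ℓ)), d x = (0 : ℝ → ℂ) x)
  · have hint : IntervalIntegrable d volume 0 ℓ := intervalIntegrable_of_Lp d ⟨hℓ.le, le_rfl⟩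
    have hcont : ContinuousOn u (Icc 0 ℓ) := by
      have h1 : ContinuousOn (fun x => u 0 + ∫ t in (0 : ℝ)..x, d t) (Icc 0 ℓ) := by
        have := intervalIntegral.continuousOn_primitive_interval' hint left_mem_uIcc
        rw [uIcc_of_le hℓ.le] at this
        exact continuousOn_const.add this
      exact h1.congr h.eq_integral
    have hu : EqOn u 0 (Icc 0 ℓ) := by
      refine Measure.eqOn_Icc_of_ae_eq volume hℓ.ne ?_ hcont continuousOn_const
      exact h.ae_eq.symm.trans (Lp.coeFn_zero _ _ _)
    have hz : ∀ x ∈ Icc 0 ℓ, ∫ t in (0 : ℝ)..x, d t = 0 := by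
      intro x hx
      have := h.eq_integral x hx
      rw [hu hx, hu ⟨le_rfl, hℓ.le⟩] at this
      simpa using this.symm
    have hder := hint.ae_hasDerivAt_integral
    rw [uIcc_of_le hℓ.le] at hder
    have hIoo : ∀ᵐ x ∂(volume.restrict (Icc (0 : ℝ) ℓ)), x ∈ Ioo 0 ℓ := by
      rw [← restrict_Ioo_eq_restrict_Icc]
      exact ae_restrict_mem measurableSet_Ioo
    filter_upwards [hIoo, ae_restrict_of_ae hder] with x hx hx'
    have h1 := hx' ⟨hx.1.le, hx.2.le⟩ 0 ⟨le_rfl, hℓ.le⟩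
    have h2 : HasDerivAt (fun x => ∫ t in (0 : ℝ)..x, d t) 0 x := by
      refine (hasDerivAt_const x (0 : ℂ)).congr_of_eventuallyEq ?_
      filter_upwards [Ioo_mem_nhds hx.1 hx.2] with y hy
      exact hz y ⟨hy.1.le, hy.2.le⟩
    exact h1.unique h2

/-- The graph of the operator `∂ₓ²`, as a subspace of `L²(Γ) × L²(Γ)`. -/
def laplacianGraph (L : ℝ) : Submodule ℂ (L2Graph L × L2Graph L) where
  carrier := {p | IsLaplacian L p.1 p.2}
  zero_mem' := by
    refine ⟨0, 0, 0, fun e => IsACRep.zero _, fun e => IsACRep.zero _, ?_, ?_⟩ <;>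
    constructor <;> simp
  add_mem' := by
    rintro ⟨w₁, g₁⟩ ⟨w₂, g₂⟩ ⟨w₁', u₁, v₁, hu₁, hv₁, hc₁, hk₁⟩ ⟨w₂', u₂, v₂, hu₂, hv₂, hc₂, hk₂⟩
    refine ⟨w₁' + w₂', u₁ + u₂, v₁ + v₂, fun e => (hu₁ e).add (hu₂ e),
      fun e => (hv₁ e).add (hv₂ e), ?_, ?_⟩
    · constructor <;> intro n
      · simp [hc₁.left_upper n, hc₂.left_upper n]
      · simp only [Pi.add_apply, hc₁.left_lower n, hc₂.left_lower n]
      · simp [hc₁.right_upper n, hc₂.right_upper n]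
      · simp only [Pi.add_apply, hc₁.right_lower n, hc₂.right_lower n]
    · constructor <;> intro n
      · simp only [Pi.add_apply, hk₁.left n, hk₂.left n]; ring
      · simp only [Pi.add_apply, hk₁.right n, hk₂.right n]; ring
  smul_mem' := by
    rintro c ⟨w, g⟩ ⟨w', u, v, hu, hv, hc, hk⟩
    refine ⟨c • w', c • u, c • v, fun e => (hu e).smul c, fun e => (hv e).smul c, ?_, ?_⟩
    · constructor <;> intro n
      · simp only [Pi.smul_apply, hc.left_upper n]
      · simp only [Pi.smul_apply, hc.left_lower n]
      · simp only [Pi.smul_apply, hc.right_upper n]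
      · simp only [Pi.smul_apply, hc.right_lower n]
    · constructor <;> intro n
      · simp only [Pi.smul_apply, hk.left n, smul_add]
      · simp only [Pi.smul_apply, hk.right n, smul_add]

/-- The second derivative is uniquely determined, so that `laplacianGraph` is the graph of a
linear map. -/
theorem laplacianGraph_single_valued (L : ℝ) (p : L2Graph L × L2Graph L)
    (hp : p ∈ laplacianGraph L) (h0 : p.1 = 0) : p.2 = 0 := by
  obtain ⟨w, g⟩ := p
  obtain ⟨w', u, v, hu, hv, -, -⟩ := hp
  dsimp only at h0 hu hv ⊢
  subst h0
  ext1
  funext e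
  have h1 : w' e = 0 := (hu e).derivative_eq_zero
  have h2 := hv e
  rw [h1] at h2
  exact h2.derivative_eq_zero

/-- The Laplacian `∂ₓ²` on `L²(Γ)`, with domain the functions in `H²(Γ)` that are continuous and
satisfy the Kirchhoff conditions at the vertices. -/
def laplacian (L : ℝ) : L2Graph L →ₗ.[ℂ] L2Graph L :=
  (laplacianGraph L).toLinearPMap

theorem laplacian_graph (L : ℝ) : (laplacian L).graph = laplacianGraph L :=
  Submodule.toLinearPMap_graph_eq _ (laplacianGraph_single_valued L)

section Spectrum

variable {H : Type*} [NormedAddCommGroup H] [NormedSpace ℂ H]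

/-- `z` is in the resolvent set of the (unbounded) operator `A`: there is a bounded operator `R`
on the whole space which is a two-sided inverse of `A - z : 𝒟(A) → H`. -/
def IsResolventPoint (A : H →ₗ.[ℂ] H) (z : ℂ) : Prop :=
  ∃ R : H →L[ℂ] H,
    (∀ f : H, ∃ h : R f ∈ A.domain, A ⟨R f, h⟩ - z • R f = f) ∧
    (∀ w : A.domain, R (A w - z • (w : H)) = w)

/-- The spectrum of an unbounded operator. -/
def unboundedSpectrum (A : H →ₗ.[ℂ] H) : Set ℂ :=
  {z | ¬ IsResolventPoint A z}

/-- The eigenspace `{w ∈ 𝒟(A) : A w = z w}` of an unbounded operator. -/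
def eigenspace (A : H →ₗ.[ℂ] H) (z : ℂ) : Submodule ℂ H :=
  (LinearMap.ker (A.toFun - z • A.domain.subtype)).map A.domain.subtype

end Spectrum

/-- The trace of the monodromy matrix,
`T(ω) = 2 cos(π ω) cos(L ω) - (5/2) sin(π ω) sin(L ω)`. -/
def discriminant (L ω : ℝ) : ℝ :=
  2 * Real.cos (Real.pi * ω) * Real.cos (L * ω)
    - 5 / 2 * Real.sin (Real.pi * ω) * Real.sin (L * ω)

end PeriodicGraph

end

namespace PeriodicGraph

/-! Write the spectral parameter as `ω²`. On each edge, variation of constants solves `-u'' = ω² u +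
f` from the Cauchy data at the left end, so the operator equation reduces to vertex conditions on
sequences. The links see only the mean value and the total derivative over the two semicircles. This
gives a recursion `X (n+1) = M X n + F n` for the data at the links, with `det M = 1` and `tr M =
T(ω)`. The remaining unknown, the difference of the two slopes at the left vertex of a circle, is
determined exactly when `sin(πω)/ω ≠ 0`, that is, when `ω²` is not some `m²` with `m ≥ 1`.

If `T(ω) ∉ [-2,2]`, both eigenvalues of `M` lie off the unit circle, the recursion is boundedly
solvable in `ℓ²(ℤ)`, and away from the `m²` this yields a resolvent
(`isResolventPoint_of_discriminant`). If `T(ω) ∈ [-2,2]`, an eigenvalue of modulus one obstructs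
solvability already for sources on one link (`not_isResolventPoint_of_discriminant`). The
homogeneous recursion never has a nonzero solution decaying in both directions, so no eigenvalues
exist besides the `m²` (`eq_zero_of_isLaplacian`). At `m²` every circle carries `sin(mx)` on one
semicircle and its negative on the other.

The bands come from `T = 9/4 cos(Pω) - 1/4 cos((π-L)ω)` with `|π-L| < P`: the first term dominates,
so `T` crosses `[-2,2]` exactly once between consecutive zeros of `sin(Pω)`. The same domination
excludes non-real `ω` with `T(ω) ∈ [-2,2]`. Finally `T(m) = 2(-1)^m cos(Lm)`, so every `m²` lies in
a band. -/

/-! ### The discriminant on the real line and the spectral bands. -/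

theorem discriminant_eq (L ω : ℝ) : discriminant L ω =
    9 / 4 * Real.cos ((L + Real.pi) * ω) - 1 / 4 * Real.cos ((Real.pi - L) * ω) := by
  rw [discriminant, add_mul, sub_mul, Real.cos_add, Real.cos_sub]
  ring

theorem discriminant_neg (L ω : ℝ) : discriminant L (-ω) = discriminant L ω := by
  simp [discriminant]

theorem discriminant_natCast_mem_Icc (L : ℝ) (m : ℕ) : discriminant L m ∈ Icc (-2) 2 := by
  have h : discriminant L m = 2 * (-1) ^ m * Real.cos (L * m) := by
    rw [discriminant, mul_comm Real.pi, Real.cos_nat_mul_pi, Real.sin_nat_mul_pi]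
    ring
  have h1 : |discriminant L m| ≤ 2 := by
    rw [h, abs_mul, abs_mul, abs_pow]
    simpa using Real.abs_cos_le_one (L * m)
  exact abs_le.1 h1

theorem continuous_discriminant (L : ℝ) : Continuous (discriminant L) := by
  unfold discriminant
  fun_prop

/-- The map `x ↦ arccos ((8 s + cos x) / 9)` is a weak contraction. -/
theorem abs_arccos_sub_arccos_le {s : ℝ} (hs : s ∈ Icc (-1) 1) (x y : ℝ) :
    |Real.arccos ((8 * s + Real.cos x) / 9) - Real.arccos ((8 * s + Real.cos y) / 9)|
      ≤ |x - y| := by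
  -- For `|s| < 1` the argument of `arccos` stays inside `(-1,1)`, where `arccos` is differentiable;
  -- `s = ±1` follows by continuity in `s`.
  have key : ∀ s ∈ Ioo (-1 : ℝ) 1,
      |Real.arccos ((8 * s + Real.cos x) / 9) - Real.arccos ((8 * s + Real.cos y) / 9)|
        ≤ |x - y| := by
    intro s hs
    have hd : ∀ t ∈ (univ : Set ℝ), HasDerivWithinAt
        (fun t => Real.arccos ((8 * s + Real.cos t) / 9))
        (-(1 / √(1 - ((8 * s + Real.cos t) / 9) ^ 2)) * (-Real.sin t / 9)) univ t := by
      intro t _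
      have h1 := Real.neg_one_le_cos t
      have h2 := Real.cos_le_one t
      have hin : HasDerivAt (fun t => (8 * s + Real.cos t) / 9) (-Real.sin t / 9) t :=
        ((Real.hasDerivAt_cos t).const_add _).div_const _
      exact ((Real.hasDerivAt_arccos (x := (8 * s + Real.cos t) / 9)
        (by linarith [hs.1]) (by linarith [hs.2])).comp t hin).hasDerivWithinAt
    have hb : ∀ t ∈ (univ : Set ℝ),
        ‖-(1 / √(1 - ((8 * s + Real.cos t) / 9) ^ 2)) * (-Real.sin t / 9)‖ ≤ 1 := by
      intro t _
      have h1 := Real.neg_one_le_cos t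
      have h2 := Real.cos_le_one t
      have hpos : 0 < 1 - ((8 * s + Real.cos t) / 9) ^ 2 := by nlinarith [hs.1, hs.2]
      rw [Real.norm_eq_abs, abs_mul, abs_neg, abs_div, abs_div, abs_neg, abs_one,
        abs_of_nonneg (Real.sqrt_nonneg _), abs_of_pos (by norm_num : (0 : ℝ) < 9),
        one_div, inv_mul_le_iff₀ (Real.sqrt_pos.2 hpos), mul_one]
      -- With `c = cos t`, the bound on the derivative amounts to `81 - (8s+c)² - (1-c²) =
      -- 16(4(1-s²) + (1-sc)) ≥ 0`.
      refine Real.le_sqrt_of_sq_le ?_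
      rw [div_pow, sq_abs]
      have h3 := Real.sin_sq_add_cos_sq t
      nlinarith [hs.1, hs.2, mul_nonneg (by linarith : (0 : ℝ) ≤ 1 - Real.cos t)
        (by linarith [hs.1] : (0 : ℝ) ≤ 1 + s), mul_nonneg
        (by linarith : (0 : ℝ) ≤ 1 + Real.cos t) (by linarith [hs.2] : (0 : ℝ) ≤ 1 - s)]
    have := convex_univ.norm_image_sub_le_of_norm_hasDerivWithin_le hd hb (mem_univ y) (mem_univ x)
    simpa using this
  have hcl : closure (Ioo (-1 : ℝ) 1) = Icc (-1) 1 := closure_Ioo (by norm_num)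
  refine le_on_closure (s := Ioo (-1 : ℝ) 1) (x := s) (f := fun s =>
    |Real.arccos ((8 * s + Real.cos x) / 9) - Real.arccos ((8 * s + Real.cos y) / 9)|)
    (g := fun _ => |x - y|) key ?_ continuousOn_const (hcl ▸ hs)
  refine Continuous.continuousOn ?_
  exact ((Real.continuous_arccos.comp (by fun_prop)).sub
    (Real.continuous_arccos.comp (by fun_prop))).abs

/-- On each interval between consecutive zeros of `sin (P ω)`, the discriminant takes each value
in `[-2, 2]` at most once. -/
theorem discriminant_level_unique {L : ℝ} (hL : 0 < L) (k : ℕ) {x y : ℝ}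
    (hx : (L + Real.pi) * x ∈ Icc (k * Real.pi) ((k + 1) * Real.pi))
    (hy : (L + Real.pi) * y ∈ Icc (k * Real.pi) ((k + 1) * Real.pi))
    (hT : discriminant L x ∈ Icc (-2) 2) (hxy : discriminant L x = discriminant L y) : x = y := by
  have hpi := Real.pi_pos
  -- Solving `T(t) = 2s` for `cos(Pt)` gives `(8s + cos((π-L)t))/9`. Subtracting `kπ` moves `Pt`
  -- into the range of `arccos` and multiplies both cosines and `s` by `(-1)^k`.
  have key : ∀ t, (L + Real.pi) * t ∈ Icc (k * Real.pi) ((k + 1) * Real.pi) →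
      (L + Real.pi) * t - k * Real.pi = Real.arccos ((8 * ((-1) ^ k * (discriminant L t / 2))
        + Real.cos ((Real.pi - L) * t - k * Real.pi)) / 9) := by
    intro t ht
    rw [← Real.arccos_cos (x := (L + Real.pi) * t - k * Real.pi) (by linarith [ht.1])
      (by linarith [ht.2])]
    congr 1
    rw [Real.cos_sub_nat_mul_pi, Real.cos_sub_nat_mul_pi, discriminant_eq]
    ring
  have hs : (-1) ^ k * (discriminant L x / 2) ∈ Icc (-1 : ℝ) 1 := by
    rcases neg_one_pow_eq_or ℝ k with h | h <;> rw [h] <;> constructor <;> linarith [hT.1, hT.2]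
  have h := abs_arccos_sub_arccos_le hs ((Real.pi - L) * x - k * Real.pi)
    ((Real.pi - L) * y - k * Real.pi)
  rw [← key x hx, hxy, ← key y hy] at h
  have h' : (L + Real.pi) * |x - y| ≤ |Real.pi - L| * |x - y| := by
    nth_rewrite 1 [← abs_of_pos (by linarith : 0 < L + Real.pi)]
    rw [← abs_mul, ← abs_mul]
    convert h using 1 <;> (congr 1; ring)
  by_contra hne
  have hpos : 0 < |x - y| := abs_pos.2 (sub_ne_zero.2 hne)
  have h2 := le_of_mul_le_mul_right h' hpos
  -- The weak contraction suffices, because `|π - L| < L + π` strictly.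
  rcases abs_cases (Real.pi - L) with h3 | h3 <;> linarith

/-- The set where `f` lies in `[-2,2]` is compact, and the intermediate value theorem together with
uniqueness of levels leaves it no gaps. Monotonicity of `f` on all of `[p,q]` is not needed: outside
the band `f` may oscillate. -/
theorem exists_Icc_bijOn_of_level_unique {f : ℝ → ℝ} {p q : ℝ} (hpq : p ≤ q)
    (hf : ContinuousOn f (Icc p q)) (hp : 2 ≤ f p) (hq : f q ≤ -2)
    (huniq : ∀ x ∈ Icc p q, ∀ y ∈ Icc p q, f x ∈ Icc (-2 : ℝ) 2 → f x = f y → x = y) :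
    ∃ a b, a < b ∧ p ≤ a ∧ b ≤ q ∧ {x ∈ Icc p q | f x ∈ Icc (-2) 2} = Icc a b ∧
      BijOn f (Icc a b) (Icc (-2) 2) := by
  set S := {x ∈ Icc p q | f x ∈ Icc (-2) 2} with hS
  have hivt : ∀ x y c, p ≤ x → x ≤ y → y ≤ q → c ≤ f x → f y ≤ c → ∃ t ∈ Icc x y, f t = c := by
    intro x y c hx hxy hy h1 h2
    exact intermediate_value_Icc' hxy (hf.mono (Icc_subset_Icc hx hy)) ⟨h2, h1⟩
  have hbij : BijOn f S (Icc (-2) 2) := by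
    refine ⟨fun x hx => hx.2, fun x hx y hy h => huniq x hx.1 y hy.1 hx.2 h, fun c hc => ?_⟩
    obtain ⟨t, ht, rfl⟩ := hivt p q c le_rfl hpq le_rfl (hc.2.trans hp) (hq.trans hc.1)
    exact ⟨t, ⟨ht, hc⟩, rfl⟩
  obtain ⟨a', ha', hfa'⟩ := hbij.surjOn (⟨by norm_num, le_rfl⟩ : (2 : ℝ) ∈ Icc (-2 : ℝ) 2)
  obtain ⟨b', hb', hfb'⟩ := hbij.surjOn (⟨le_rfl, by norm_num⟩ : (-2 : ℝ) ∈ Icc (-2 : ℝ) 2)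
  have hcomp : IsCompact S := by
    refine isCompact_Icc.of_isClosed_subset ?_ (sep_subset _ _)
    exact hf.preimage_isClosed_of_isClosed isClosed_Icc isClosed_Icc
  have hne : S.Nonempty := ⟨a', ha'⟩
  have haS := hcomp.sInf_mem hne
  have hbS := hcomp.sSup_mem hne
  have hSeq : S = Icc (sInf S) (sSup S) := by
    refine Subset.antisymm (fun x hx => ⟨csInf_le hcomp.bddBelow hx, le_csSup hcomp.bddAbove hx⟩) ?_
    intro z hz
    have hz1 : z ∈ Icc p q := ⟨haS.1.1.trans hz.1, hz.2.trans hbS.1.2⟩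
    -- If `f z < -2`, the value at `sSup S` is taken again on `[p,z]`; if `f z > 2`, the value at
    -- `sInf S` is taken again on `[z,q]`. Either contradicts uniqueness.
    refine ⟨hz1, ?_, ?_⟩
    · by_contra hlt
      push Not at hlt
      obtain ⟨t, ht, hft⟩ := hivt p z (f (sSup S)) le_rfl hz1.1 hz1.2 (hbS.2.2.trans hp)
        (hlt.le.trans hbS.2.1)
      have h1 := huniq _ hbS.1 t ⟨ht.1, ht.2.trans hz1.2⟩ hbS.2 hft.symm
      have h2 : z = sSup S := le_antisymm hz.2 (h1 ▸ ht.2)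
      exact absurd hbS.2.1 (not_le.2 (h2 ▸ hlt))
    · by_contra hlt
      push Not at hlt
      obtain ⟨t, ht, hft⟩ := hivt z q (f (sInf S)) hz1.1 hz1.2 le_rfl (haS.2.2.trans hlt.le)
        (hq.trans haS.2.1)
      have h1 := huniq _ haS.1 t ⟨hz1.1.trans ht.1, ht.2⟩ haS.2 hft.symm
      have h2 : z = sInf S := le_antisymm (h1 ▸ ht.1) hz.1
      exact absurd haS.2.2 (not_le.2 (h2 ▸ hlt))
  refine ⟨sInf S, sSup S, ?_, haS.1.1, hbS.1.2, hSeq, hSeq ▸ hbij⟩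
  by_contra hle
  push Not at hle
  have h1 : a' = b' := by
    rw [hSeq] at ha' hb'
    linarith [ha'.1, ha'.2, hb'.1, hb'.2]
  rw [h1, hfb'] at hfa'
  norm_num at hfa'

theorem exists_frequency_band {L : ℝ} (hL : 0 < L) (k : ℕ) :
    ∃ a b, a < b ∧ k * Real.pi / (L + Real.pi) ≤ a ∧ b ≤ (k + 1) * Real.pi / (L + Real.pi) ∧
      {x ∈ Icc (k * Real.pi / (L + Real.pi)) ((k + 1) * Real.pi / (L + Real.pi)) |
        discriminant L x ∈ Icc (-2) 2} = Icc a b ∧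
      BijOn (discriminant L) (Icc a b) (Icc (-2) 2) := by
  have hpi := Real.pi_pos
  have hP : 0 < L + Real.pi := by linarith
  have hle : k * Real.pi / (L + Real.pi) ≤ (k + 1) * Real.pi / (L + Real.pi) := by
    gcongr; linarith
  -- At `Px = jπ` the first cosine is `(-1)^j`, so the signed discriminant is at least `9/4 - 1/4 =
  -- 2`.
  have hval : ∀ j : ℕ, 2 ≤ (-1) ^ j * discriminant L (j * Real.pi / (L + Real.pi)) := by
    intro j
    rw [discriminant_eq, mul_div_cancel₀ _ hP.ne', Real.cos_nat_mul_pi]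
    have h1 := Real.neg_one_le_cos ((Real.pi - L) * (j * Real.pi / (L + Real.pi)))
    have h2 := Real.cos_le_one ((Real.pi - L) * (j * Real.pi / (L + Real.pi)))
    rcases neg_one_pow_eq_or ℝ j with h | h <;> rw [h] <;> linarith
  have hmem : ∀ x ∈ Icc (k * Real.pi / (L + Real.pi)) ((k + 1) * Real.pi / (L + Real.pi)),
      (L + Real.pi) * x ∈ Icc (k * Real.pi) ((k + 1) * Real.pi) := by
    intro x hx
    rw [mem_Icc, div_le_iff₀ hP, le_div_iff₀ hP] at hx
    exact ⟨by linarith [hx.1], by linarith [hx.2]⟩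
  have h1 := hval k
  have h2 := hval (k + 1)
  push_cast at h2
  have huniq := fun x hx y hy => discriminant_level_unique hL k (hmem x hx) (hmem y hy)
  rcases neg_one_pow_eq_or ℝ k with h | h
  · rw [pow_succ, h] at h2
    rw [h] at h1
    exact exists_Icc_bijOn_of_level_unique hle (continuous_discriminant L).continuousOn
      (by linarith) (by linarith) huniq
  · rw [pow_succ, h] at h2
    rw [h] at h1
    have hneg : ∀ t : ℝ, -t ∈ Icc (-2 : ℝ) 2 ↔ t ∈ Icc (-2 : ℝ) 2 := by
      intro t
      constructor <;> rintro ⟨h3, h4⟩ <;> constructor <;> linarith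
    -- Where `(-1)^k = -1` the discriminant rises from at most `-2` to at least `2`, so its negative
    -- is used.
    obtain ⟨a, b, hab, hpa, hbq, hS, hB⟩ := exists_Icc_bijOn_of_level_unique
      (f := fun x => -discriminant L x) hle
      (continuous_discriminant L).neg.continuousOn (by linarith) (by linarith)
      (fun x hx y hy h3 h4 => huniq x hx y hy ((hneg _).1 h3) (neg_injective h4))
    simp only [hneg] at hS
    refine ⟨a, b, hab, hpa, hbq, hS, fun x hx => (hneg _).1 (hB.mapsTo hx),
      fun x hx y hy h3 => hB.injOn hx hy (by simpa using h3), fun c hc => ?_⟩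
    obtain ⟨x, hx, hxc⟩ := hB.surjOn ((hneg c).2 hc)
    exact ⟨x, hx, by simpa using hxc⟩

theorem exists_spectral_bands {L : ℝ} (hL : 0 < L) :
    ∃ a b : ℕ → ℝ, (∀ k, a k < b k) ∧ (∀ k, b k ≤ a (k + 1)) ∧
      (∀ k, BijOn (fun lam : ℝ => discriminant L (Real.sqrt lam)) (Icc (a k) (b k))
        (Icc (-2) 2)) ∧
      (⋃ k, Icc (a k) (b k)) =
        {lam : ℝ | ∃ ω : ℝ, lam = ω ^ 2 ∧ discriminant L ω ∈ Icc (-2) 2} := by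
  have hpi := Real.pi_pos
  have hP : 0 < L + Real.pi := by linarith
  choose α β hlt hα hβ hS hB using exists_frequency_band hL
  have hα0 : ∀ k, 0 ≤ α k := fun k => le_trans (by positivity) (hα k)
  have hβ0 : ∀ k, 0 ≤ β k := fun k => (hα0 k).trans (hlt k).le
  have hsqrt : ∀ k, BijOn Real.sqrt (Icc (α k ^ 2) (β k ^ 2)) (Icc (α k) (β k)) := by
    intro k
    refine ⟨fun x hx => ⟨Real.le_sqrt_of_sq_le hx.1, Real.sqrt_le_iff.2 ⟨hβ0 k, hx.2⟩⟩,
      fun x hx y hy h => ?_, fun x hx => ⟨x ^ 2, ⟨?_, ?_⟩, ?_⟩⟩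
    · exact (Real.sqrt_inj ((sq_nonneg _).trans hx.1) ((sq_nonneg _).trans hy.1)).1 h
    · exact pow_le_pow_left₀ (hα0 k) hx.1 2
    · exact pow_le_pow_left₀ ((hα0 k).trans hx.1) hx.2 2
    · exact Real.sqrt_sq ((hα0 k).trans hx.1)
  refine ⟨fun k => α k ^ 2, fun k => β k ^ 2, fun k => ?_, fun k => ?_, fun k => ?_, ?_⟩
  · exact pow_lt_pow_left₀ (hlt k) (hα0 k) two_ne_zero
  · refine pow_le_pow_left₀ (hβ0 k) ((hβ k).trans ?_) 2
    simpa using hα (k + 1)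
  · exact (hB k).comp (hsqrt k)
  · ext lam
    simp only [mem_iUnion, mem_ofPred_eq]
    constructor
    · rintro ⟨k, hk⟩
      refine ⟨√lam, (Real.sq_sqrt ((sq_nonneg _).trans hk.1)).symm, ?_⟩
      exact (hB k).mapsTo ((hsqrt k).mapsTo hk)
    · rintro ⟨ω, rfl, hω⟩
      have habs : discriminant L |ω| ∈ Icc (-2) 2 := by
        rcases abs_choice ω with h | h <;> rw [h]
        · exact hω
        · rwa [discriminant_neg]
      have hk1 := Nat.floor_le (by positivity : 0 ≤ (L + Real.pi) * |ω| / Real.pi)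
      have hk2 := Nat.lt_floor_add_one ((L + Real.pi) * |ω| / Real.pi)
      -- The index of the interval `[kπ/P, (k+1)π/P]` containing `|ω|`.
      set k := ⌊(L + Real.pi) * |ω| / Real.pi⌋₊
      refine ⟨k, ?_⟩
      rw [le_div_iff₀ hpi] at hk1
      rw [div_lt_iff₀ hpi] at hk2
      have hmem : |ω| ∈ Icc (α k) (β k) := by
        rw [← hS k]
        refine ⟨⟨?_, ?_⟩, habs⟩
        · rw [div_le_iff₀ hP]; linarith
        · rw [le_div_iff₀ hP]; linarith
      rw [← sq_abs ω]
      exact ⟨pow_le_pow_left₀ (hα0 k) hmem.1 2, pow_le_pow_left₀ (abs_nonneg _) hmem.2 2⟩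

/-! ### Non-real frequencies. -/

/-- The cosine maps horizontal lines into ellipses with foci `±1`. By the half-angle formulas the
two focal distances are `2|sin(w/2)|²` and `2|cos(w/2)|²`. -/
theorem norm_cos_sub_one_add_norm_cos_add_one (w : ℂ) :
    ‖Complex.cos w - 1‖ + ‖Complex.cos w + 1‖ = 2 * Real.cosh w.im := by
  have h1 : Complex.cos w - 1 = -2 * Complex.sin (w / 2) ^ 2 := by
    have := Complex.cos_two_mul (w / 2)
    rw [mul_div_cancel₀ _ two_ne_zero, Complex.cos_sq'] at this
    rw [this]; ring
  have h2 : Complex.cos w + 1 = 2 * Complex.cos (w / 2) ^ 2 := by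
    have := Complex.cos_two_mul (w / 2)
    rw [mul_div_cancel₀ _ two_ne_zero] at this
    rw [this]; ring
  have him : w.im = 2 * (w / 2).im := by
    rw [show (w / 2).im = w.im / 2 from Complex.div_ofNat_im w 2]; ring
  rw [h1, h2, norm_mul, norm_mul, norm_pow, norm_pow, him]
  generalize w / 2 = v
  have h3 : ‖Complex.sin v‖ ^ 2 = Real.sin v.re ^ 2 + Real.sinh v.im ^ 2 := by
    rw [← Complex.normSq_eq_norm_sq, Complex.sin_eq, Complex.normSq_apply]
    simp only [← Complex.ofReal_sin, ← Complex.ofReal_cos, ← Complex.ofReal_sinh,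
      ← Complex.ofReal_cosh, ← Complex.ofReal_mul, Complex.add_re, Complex.add_im,
      Complex.ofReal_re, Complex.ofReal_im, Complex.mul_re, Complex.mul_im, Complex.I_re,
      Complex.I_im]
    nlinarith [Real.sin_sq_add_cos_sq v.re, Real.cosh_sq v.im]
  have h4 : ‖Complex.cos v‖ ^ 2 = Real.cos v.re ^ 2 + Real.sinh v.im ^ 2 := by
    rw [← Complex.normSq_eq_norm_sq, Complex.cos_eq, Complex.normSq_apply]
    simp only [← Complex.ofReal_sin, ← Complex.ofReal_cos, ← Complex.ofReal_sinh,
      ← Complex.ofReal_cosh, ← Complex.ofReal_mul, Complex.sub_re, Complex.sub_im,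
      Complex.ofReal_re, Complex.ofReal_im, Complex.mul_re, Complex.mul_im, Complex.I_re,
      Complex.I_im]
    nlinarith [Real.sin_sq_add_cos_sq v.re, Real.cosh_sq v.im]
  rw [h3, h4, Real.cosh_two_mul, Real.cosh_sq]
  simp only [norm_neg, Complex.norm_ofNat]
  linarith [Real.sin_sq_add_cos_sq v.re]

/-- The discriminant, as an entire function of the frequency. -/
noncomputable def complexDiscriminant (L : ℝ) (ω : ℂ) : ℂ :=
  2 * Complex.cos (Real.pi * ω) * Complex.cos (L * ω)
    - 5 / 2 * Complex.sin (Real.pi * ω) * Complex.sin (L * ω)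

theorem complexDiscriminant_ofReal (L ω : ℝ) :
    complexDiscriminant L ω = (discriminant L ω : ℂ) := by
  simp [complexDiscriminant, discriminant]

/-- Here `cos(Pω)` is the convex combination, with weights `8/9` and `1/9`, of the real point `t/2`
between the foci and of `cos((π-L)ω)`. Convexity of the sum of focal distances gives `2 cosh(P Im ω)
≤ (16 + 2 cosh((π-L) Im ω))/9`; the right side is at most `(16 + 2 cosh(P Im ω))/9`, so `cosh(P Im
ω) ≤ 1`. -/
theorem im_eq_zero_of_complexDiscriminant_mem {L : ℝ} (hL : 0 < L) {ω : ℂ} {t : ℝ}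
    (ht : t ∈ Icc (-2) 2) (h : complexDiscriminant L ω = t) : ω.im = 0 := by
  have hpi := Real.pi_pos
  have h1 : Complex.cos ((L + Real.pi) * ω) =
      (4 * t + Complex.cos ((Real.pi - L) * ω)) / 9 := by
    rw [← h, complexDiscriminant, add_mul, sub_mul, Complex.cos_add, Complex.cos_sub]
    ring
  have e1 := norm_cos_sub_one_add_norm_cos_add_one ((L + Real.pi) * ω)
  have e2 := norm_cos_sub_one_add_norm_cos_add_one ((Real.pi - L) * ω)
  have i1 : (((L : ℂ) + Real.pi) * ω).im = (L + Real.pi) * ω.im := by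
    rw [← Complex.ofReal_add, Complex.im_ofReal_mul]
  have i2 : (((Real.pi : ℂ) - L) * ω).im = (Real.pi - L) * ω.im := by
    rw [← Complex.ofReal_sub, Complex.im_ofReal_mul]
  rw [i1, h1] at e1
  rw [i2] at e2
  set c := Complex.cos ((Real.pi - L) * ω)
  have b1 : ‖(4 * t + c) / 9 - 1‖ ≤ ((8 - 4 * t) + ‖c - 1‖) / 9 := by
    have : (4 * t + c) / 9 - 1 = (-((8 - 4 * t : ℝ) : ℂ) + (c - 1)) / 9 := by
      push_cast; ring
    rw [this, norm_div, Complex.norm_ofNat]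
    gcongr
    refine (norm_add_le _ _).trans (le_of_eq ?_)
    rw [norm_neg, Complex.norm_real, Real.norm_of_nonneg (by linarith [ht.2])]
  have b2 : ‖(4 * t + c) / 9 + 1‖ ≤ ((8 + 4 * t) + ‖c + 1‖) / 9 := by
    have : (4 * t + c) / 9 + 1 = (((8 + 4 * t : ℝ) : ℂ) + (c + 1)) / 9 := by
      push_cast; ring
    rw [this, norm_div, Complex.norm_ofNat]
    gcongr
    refine (norm_add_le _ _).trans (le_of_eq ?_)
    rw [Complex.norm_real, Real.norm_of_nonneg (by linarith [ht.1])]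
  by_contra hne
  have hcosh : Real.cosh ((Real.pi - L) * ω.im) ≤ Real.cosh ((L + Real.pi) * ω.im) := by
    rw [Real.cosh_le_cosh, abs_mul, abs_mul]
    refine mul_le_mul_of_nonneg_right ?_ (abs_nonneg _)
    rw [abs_le, abs_of_pos (by linarith)]
    constructor <;> linarith
  have hgt : 1 < Real.cosh ((L + Real.pi) * ω.im) :=
    Real.one_lt_cosh.2 (mul_ne_zero (by linarith) hne)
  linarith

/-! ### Block operators and two-term recursions over `ℤ`. -/

/-- A block operator between Hilbert sums, each block of the target depending on one block of the
source only, and each block of the source being used at most `N` times. -/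
theorem exists_lp_blockMap {I J : Type*} {E : I → Type*} {F : J → Type*}
    [∀ i, NormedAddCommGroup (E i)] [∀ i, NormedSpace ℂ (E i)]
    [∀ j, NormedAddCommGroup (F j)] [∀ j, NormedSpace ℂ (F j)] (σ : J → I) (N : ℕ)
    (hσ : ∀ i, (σ ⁻¹' {i}).encard ≤ N) (T : ∀ j, E (σ j) →L[ℂ] F j) {C : ℝ} (hC0 : 0 ≤ C)
    (hC : ∀ j, ‖T j‖ ≤ C) :
    ∃ Φ : lp E 2 →L[ℂ] lp F 2, (∀ x j, Φ x j = T j (x (σ j))) ∧ ‖Φ‖ ≤ √N * C := by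
  classical
  have hbound : ∀ (x : lp E 2) (s : Finset J),
      ∑ j ∈ s, ‖T j (x (σ j))‖ ^ (2 : ENNReal).toReal ≤
        (√N * C * ‖x‖) ^ (2 : ENNReal).toReal := by
    intro x s
    have hsum := lp.sum_rpow_le_norm_rpow (p := 2) (by norm_num) x (s.image σ)
    simp only [ENNReal.toReal_ofNat, Real.rpow_ofNat] at hsum ⊢
    calc ∑ j ∈ s, ‖T j (x (σ j))‖ ^ 2 ≤ ∑ j ∈ s, C ^ 2 * ‖x (σ j)‖ ^ 2 := by
          refine Finset.sum_le_sum fun j _ => ?_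
          rw [← mul_pow]
          exact pow_le_pow_left₀ (norm_nonneg _) ((T j).le_of_opNorm_le (hC j) _) 2
      _ = C ^ 2 * ∑ i ∈ s.image σ, (s.filter (σ · = i)).card • ‖x i‖ ^ 2 := by
          rw [← Finset.mul_sum, Finset.sum_comp (fun i => ‖x i‖ ^ 2) σ]
      _ ≤ C ^ 2 * ∑ i ∈ s.image σ, N * ‖x i‖ ^ 2 := by
          gcongr with i _
          rw [nsmul_eq_mul]
          gcongr
          have h1 : ((s.filter (σ · = i) : Finset J) : Set J) ⊆ σ ⁻¹' {i} := by
            intro j hj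
            simpa using (Finset.mem_filter.1 hj).2
          have h2 := (Set.encard_le_encard h1).trans (hσ i)
          rw [Set.encard_coe_eq_coe_finsetCard] at h2
          exact_mod_cast h2
      _ = N * C ^ 2 * ∑ i ∈ s.image σ, ‖x i‖ ^ 2 := by rw [← Finset.mul_sum]; ring
      _ ≤ N * C ^ 2 * ‖x‖ ^ 2 := by gcongr
      _ = (√N * C * ‖x‖) ^ 2 := by
          rw [mul_pow, mul_pow, Real.sq_sqrt (Nat.cast_nonneg N)]
  let Φ₀ : lp E 2 →ₗ[ℂ] lp F 2 :=
    { toFun := fun x => ⟨fun j => T j (x (σ j)), memℓp_gen' (hbound x)⟩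
      map_add' := fun x y => by
        ext j
        exact map_add _ _ _
      map_smul' := fun c x => by
        ext j
        simp }
  have hΦ : ∀ x, ‖Φ₀ x‖ ≤ √N * C * ‖x‖ := fun x =>
    lp.norm_le_of_forall_sum_le (by norm_num) (by positivity) (hbound x)
  exact ⟨Φ₀.mkContinuous _ hΦ, fun x j => rfl, Φ₀.mkContinuous_norm_le (by positivity) hΦ⟩

/-- The space `ℓ²(ℤ)`. -/
abbrev L2Int : Type := lp (fun _ : ℤ => ℂ) 2

theorem exists_shift (m : ℤ) : ∃ S : L2Int →L[ℂ] L2Int, (∀ x n, S x n = x (n + m)) ∧ ‖S‖ ≤ 1 := by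
  have hfib : ∀ i : ℤ, ((fun n : ℤ => n + m) ⁻¹' {i}).encard ≤ (1 : ℕ) := by
    intro i
    rw [Nat.cast_one, Set.encard_le_one_iff]
    intro a b ha hb
    simp only [mem_preimage, mem_singleton_iff] at ha hb
    omega
  obtain ⟨S, h1, h2⟩ := exists_lp_blockMap (E := fun _ : ℤ => ℂ) (F := fun _ : ℤ => ℂ)
    (fun n : ℤ => n + m) 1 hfib (fun _ => ContinuousLinearMap.id ℂ ℂ) zero_le_one
    (fun _ => ContinuousLinearMap.norm_id_le)
  exact ⟨S, h1, by simpa using h2⟩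

/-- For `‖μ‖ ≠ 1`, the shift minus `μ` has a bounded right inverse on `ℓ²(ℤ)`. -/
theorem exists_shift_sub_inverse {μ : ℂ} (hμ : ‖μ‖ ≠ 1) :
    ∃ Q : L2Int →L[ℂ] L2Int, ∀ x n, Q x (n + 1) - μ * Q x n = x n := by
  have key : ∀ A : L2Int →L[ℂ] L2Int, ‖A‖ < 1 →
      ∃ B : L2Int →L[ℂ] L2Int, ∀ x n, B x n - A (B x) n = x n := by
    intro A hA
    obtain ⟨B, hB⟩ := (isUnit_one_sub_of_norm_lt_one hA).exists_right_inv
    refine ⟨B, fun x n => ?_⟩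
    have := congrArg (fun C : L2Int →L[ℂ] L2Int => C x n) hB
    simpa using this
  -- A Neumann series in either case: in powers of `μ` times the backward shift if `|μ| < 1`, of
  -- `μ⁻¹` times the forward shift if `|μ| > 1`.
  rcases lt_or_gt_of_ne hμ with h | h
  · obtain ⟨S, hS, hS1⟩ := exists_shift (-1)
    obtain ⟨B, hB⟩ := key (μ • S) (by
      rw [norm_smul]
      exact (mul_le_of_le_one_right (norm_nonneg _) hS1).trans_lt h)
    refine ⟨S.comp B, fun x n => ?_⟩
    have := hB x n
    simpa [hS] using this
  · have hμ0 : μ ≠ 0 := fun h0 => by simp [h0] at h; linarith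
    obtain ⟨S, hS, hS1⟩ := exists_shift 1
    obtain ⟨B, hB⟩ := key (μ⁻¹ • S) (by
      rw [norm_smul, norm_inv]
      exact (mul_le_of_le_one_right (by positivity) hS1).trans_lt (inv_lt_one_of_one_lt₀ h))
    refine ⟨-μ⁻¹ • B, fun x n => ?_⟩
    have := hB x n
    simp only [smul_apply, lp.coeFn_smul, Pi.smul_apply, hS, smul_eq_mul,
      neg_smul, lp.coeFn_neg, Pi.neg_apply, neg_apply] at this ⊢
    rw [← this]
    field_simp
    ring

theorem exists_add_eq_mul_eq_one (T : ℂ) : ∃ μ ν : ℂ, μ + ν = T ∧ μ * ν = 1 := by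
  obtain ⟨r, hr⟩ := IsAlgClosed.exists_pow_nat_eq (T ^ 2 - 4) two_pos
  exact ⟨(T + r) / 2, (T - r) / 2, by ring, by linear_combination -hr / 4⟩

/-- On the unit circle `ν = μ⁻¹` is the conjugate of `μ`, which makes the trace `2 Re μ ∈ [-2,2]`.
-/
theorem norm_ne_one_of_forall_ne {μ ν T : ℂ} (hT : ∀ t ∈ Icc (-2 : ℝ) 2, T ≠ t)
    (h1 : μ + ν = T) (h2 : μ * ν = 1) : ‖μ‖ ≠ 1 := by
  intro h
  have h3 : ν = (starRingEnd ℂ) μ := by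
    rw [← Complex.inv_eq_conj h]
    exact eq_inv_of_mul_eq_one_right h2
  refine hT (2 * μ.re) ?_ ?_
  · have := abs_le.1 ((Complex.abs_re_le_norm μ).trans h.le)
    constructor <;> linarith [this.1, this.2]
  · rw [← h1, h3, Complex.add_conj]

theorem exists_norm_eq_one {t : ℝ} (ht : t ∈ Icc (-2) 2) :
    ∃ μ ν : ℂ, μ + ν = t ∧ μ * ν = 1 ∧ ‖μ‖ = 1 := by
  have h := Real.cos_arccos (x := t / 2) (by linarith [ht.1]) (by linarith [ht.2])
  refine ⟨Complex.exp (Real.arccos (t / 2) * Complex.I),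
    Complex.exp (-(Real.arccos (t / 2) * Complex.I)), ?_, ?_, Complex.norm_exp_ofReal_mul_I _⟩
  · have h2 : (t : ℂ) = 2 * Complex.cos (Real.arccos (t / 2)) := by
      rw [← Complex.ofReal_cos, h]
      push_cast
      ring
    rw [h2, Complex.two_cos, neg_mul]
  · rw [← Complex.exp_add, add_neg_cancel, Complex.exp_zero]

/-- If the trace of a unimodular matrix is not in `[-2, 2]`, the recursion `X (n + 1) = M X n + F n`
has an `ℓ²` solution that depends continuously on `F`. -/
theorem exists_recursion_solution {H : Type*} [NormedAddCommGroup H] [NormedSpace ℂ H]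
    {a b c d : ℂ} (hdet : a * d - b * c = 1) (hT : ∀ t ∈ Icc (-2 : ℝ) 2, a + d ≠ t)
    (F G : H →L[ℂ] L2Int) :
    ∃ X Y : H →L[ℂ] L2Int, ∀ h n, X h (n + 1) = a * X h n + b * Y h n + F h n ∧
      Y h (n + 1) = c * X h n + d * Y h n + G h n := by
  obtain ⟨μ, ν, h1, h2⟩ := exists_add_eq_mul_eq_one (a + d)
  obtain ⟨Q₁, hQ₁⟩ := exists_shift_sub_inverse (norm_ne_one_of_forall_ne hT h1 h2)
  obtain ⟨Q₂, hQ₂⟩ := exists_shift_sub_inverse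
    (norm_ne_one_of_forall_ne hT ((add_comm _ _).trans h1) ((mul_comm _ _).trans h2))
  obtain ⟨S, hS, -⟩ := exists_shift 1
  have key : ∀ x n, Q₁ (Q₂ x) (n + 1 + 1) = (a + d) * Q₁ (Q₂ x) (n + 1) - Q₁ (Q₂ x) n + x n := by
    intro x n
    have e1 := hQ₁ (Q₂ x) (n + 1)
    have e2 := hQ₁ (Q₂ x) n
    have e3 := hQ₂ x n
    rw [← e1, ← e2] at e3
    linear_combination e3 + Q₁ (Q₂ x) (n + 1) * h1 - Q₁ (Q₂ x) n * h2
  -- By Cramer's rule the inverse of `S - M` is its adjugate times the inverse of `S² - (a+d)S + 1 =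
  -- (S-μ)(S-ν)`, for which `Q₁ ∘L Q₂` is a right inverse.
  refine ⟨S ∘L Q₁ ∘L Q₂ ∘L F - d • (Q₁ ∘L Q₂ ∘L F) + b • (Q₁ ∘L Q₂ ∘L G),
    S ∘L Q₁ ∘L Q₂ ∘L G - a • (Q₁ ∘L Q₂ ∘L G) + c • (Q₁ ∘L Q₂ ∘L F), fun h n => ?_⟩
  simp only [add_apply, sub_apply,
    smul_apply, ContinuousLinearMap.comp_apply, lp.coeFn_add, lp.coeFn_sub,
    lp.coeFn_smul, Pi.add_apply, Pi.sub_apply, Pi.smul_apply, smul_eq_mul, hS, key]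
  constructor
  · linear_combination Q₁ (Q₂ (F h)) n * hdet
  · linear_combination Q₁ (Q₂ (G h)) n * hdet

theorem eq_zero_of_norm_le_comp {x : ℤ → ℂ} (hx : Tendsto x cofinite (nhds 0)) {n : ℤ} {f : ℕ → ℤ}
    (hf : Function.Injective f) (h : ∀ k, ‖x n‖ ≤ ‖x (f k)‖) : x n = 0 := by
  have h1 := (hx.comp hf.tendsto_cofinite).norm
  rw [norm_zero] at h1
  exact norm_le_zero_iff.1 (ge_of_tendsto' h1 h)

theorem eq_zero_of_geometric {x : ℤ → ℂ} (hx : Tendsto x cofinite (nhds 0)) {μ : ℂ} (hμ : μ ≠ 0)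
    (h : ∀ n, x (n + 1) = μ * x n) (n : ℤ) : x n = 0 := by
  have hpos := norm_pos_iff.2 hμ
  rcases le_total 1 ‖μ‖ with h1 | h1
  · refine eq_zero_of_norm_le_comp hx (f := fun k : ℕ => n + k) (fun a b hab => by simpa using hab)
      fun k => ?_
    induction k with
    | zero => simp
    | succ k ih =>
      refine ih.trans ?_
      push_cast
      rw [← add_assoc, h, norm_mul]
      exact le_mul_of_one_le_left (norm_nonneg _) h1
  · refine eq_zero_of_norm_le_comp hx (f := fun k : ℕ => n - k) (fun a b hab => by simpa using hab)
      fun k => ?_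
    induction k with
    | zero => simp
    | succ k ih =>
      refine ih.trans ?_
      push_cast
      have := h (n - (k + 1))
      rw [show n - ((k : ℤ) + 1) + 1 = n - k by ring] at this
      rw [this, norm_mul]
      exact mul_le_of_le_one_left (norm_nonneg _) h1

/-- A recursion `X (n + 1) = M X n` with a unimodular matrix `M` has no nonzero solution decaying in
both directions. -/
theorem eq_zero_of_recursion {a b c d : ℂ} (hdet : a * d - b * c = 1) {x y : ℤ → ℂ}
    (hx : Tendsto x cofinite (nhds 0)) (hy : Tendsto y cofinite (nhds 0))
    (h1 : ∀ n, x (n + 1) = a * x n + b * y n) (h2 : ∀ n, y (n + 1) = c * x n + d * y n) :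
    x = 0 ∧ y = 0 := by
  obtain ⟨μ, ν, e1, e2⟩ := exists_add_eq_mul_eq_one (a + d)
  have key : ∀ u : ℤ → ℂ, Tendsto u cofinite (nhds 0) →
      (∀ n, u (n + 1 + 1) = (a + d) * u (n + 1) - u n) → u = 0 := by
    intro u hu hrec
    have hshift : Tendsto (fun n => u (n + 1)) cofinite (nhds 0) :=
      hu.comp (add_left_injective (1 : ℤ)).tendsto_cofinite
    -- By Cayley–Hamilton each component satisfies the scalar recursion with roots `μ`, `ν`; hence
    -- `u (n+1) - μ u n` is geometric with ratio `ν`. Once it vanishes, `u` itself is geometric.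
    have hz := eq_zero_of_geometric (x := fun n => u (n + 1) - μ * u n)
      (by simpa using hshift.sub (hu.const_mul μ)) (right_ne_zero_of_mul_eq_one e2) fun n => by
        simp only [hrec]
        linear_combination -u (n + 1) * e1 + u n * e2
    funext n
    exact eq_zero_of_geometric hu (left_ne_zero_of_mul_eq_one e2)
      (fun n => sub_eq_zero.1 (hz n)) n
  refine ⟨key x hx fun n => ?_, key y hy fun n => ?_⟩
  · simp only [h1, h2]
    linear_combination -x n * hdet
  · simp only [h1, h2]
    linear_combination -y n * hdet

/-- If the trace of a unimodular matrix `M` is in `[-2, 2]`, there is a linear form `(p, q) ≠ 0`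
which annihilates every `F` such that the recursion `X (n + 1) = M X n + δ_{n 0} F` has a decaying
solution. -/
theorem exists_linear_form_obstruction {a b c d : ℂ} (hdet : a * d - b * c = 1) {t : ℝ}
    (ht : t ∈ Icc (-2) 2) (htr : a + d = t) :
    ∃ p q : ℂ, (p ≠ 0 ∨ q ≠ 0) ∧ ∀ (x y f g : ℤ → ℂ),
      Tendsto x cofinite (nhds 0) → Tendsto y cofinite (nhds 0) →
      (∀ n, x (n + 1) = a * x n + b * y n + f n) → (∀ n, y (n + 1) = c * x n + d * y n + g n) →
      (∀ n ≠ 0, f n = 0 ∧ g n = 0) → p * f 0 + q * g 0 = 0 := by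
  obtain ⟨μ, ν, e1, e2, e3⟩ := exists_norm_eq_one ht
  -- A left eigenvector of `M` for an eigenvalue of modulus one. Away from `n = 0` the modulus of `p
  -- x + q y` is then constant, so decay makes `p x + q y` vanish on both sides of the source.
  obtain ⟨p, q, hpq, l1, l2⟩ : ∃ p q : ℂ, (p ≠ 0 ∨ q ≠ 0) ∧ p * a + q * c = μ * p ∧
      p * b + q * d = μ * q := by
    have hdet' : (!![a - μ, b; c, d - μ] : Matrix (Fin 2) (Fin 2) ℂ).det = 0 := by
      rw [Matrix.det_fin_two_of]
      linear_combination hdet - μ * htr + μ * e1 - e2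
    obtain ⟨v, hv0, hv⟩ := Matrix.exists_vecMul_eq_zero_iff.2 hdet'
    refine ⟨v 0, v 1, ?_, ?_, ?_⟩
    · by_contra hcon
      push Not at hcon
      exact hv0 (by ext i; fin_cases i <;> simp [hcon])
    · have := congrFun hv 0
      simp [Matrix.vecMul, dotProduct, Fin.sum_univ_two] at this
      linear_combination this
    · have := congrFun hv 1
      simp [Matrix.vecMul, dotProduct, Fin.sum_univ_two] at this
      linear_combination this
  refine ⟨p, q, hpq, fun x y f g hx hy hxr hyr hfg => ?_⟩
  have hrec : ∀ n, p * x (n + 1) + q * y (n + 1) =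
      μ * (p * x n + q * y n) + (p * f n + q * g n) := by
    intro n
    rw [hxr, hyr]
    linear_combination x n * l1 + y n * l2
  have hz : Tendsto (fun n => p * x n + q * y n) cofinite (nhds 0) := by
    simpa using (hx.const_mul p).add (hy.const_mul q)
  have hnorm : ∀ n ≠ 0, ‖p * x (n + 1) + q * y (n + 1)‖ = ‖p * x n + q * y n‖ := by
    intro n hn
    rw [hrec, (hfg n hn).1, (hfg n hn).2, mul_zero, mul_zero, add_zero, add_zero, norm_mul, e3,
      one_mul]
  have z1 : p * x 1 + q * y 1 = 0 := by
    refine eq_zero_of_norm_le_comp (x := fun n => p * x n + q * y n) hz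
      (f := fun k : ℕ => 1 + k) (fun a b hab => by simpa using hab) fun k => ?_
    induction k with
    | zero => simp
    | succ k ih =>
      refine ih.trans (le_of_eq ?_)
      push_cast
      rw [← add_assoc]
      exact (hnorm (1 + k) (by omega)).symm
  have z0 : p * x 0 + q * y 0 = 0 := by
    refine eq_zero_of_norm_le_comp (x := fun n => p * x n + q * y n) hz
      (f := fun k : ℕ => 0 - k) (fun a b hab => by simpa using hab) fun k => ?_
    induction k with
    | zero => simp
    | succ k ih =>
      refine ih.trans (le_of_eq ?_)
      push_cast
      have := hnorm (0 - (k + 1)) (by omega)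
      rwa [show (0 : ℤ) - (k + 1) + 1 = 0 - k by ring] at this
  have := hrec 0
  rw [zero_add, z1, z0, mul_zero, zero_add] at this
  exact this.symm

/-! ### Variation of constants on one edge. -/

/-- The solution of `-y'' = ω² y` with `y 0 = 1` and `y' 0 = 0`. -/
noncomputable def cosSol (ω : ℂ) (x : ℝ) : ℂ := Complex.cos (ω * x)

/-- The solution of `-y'' = ω² y` with `y 0 = 0` and `y' 0 = 1`. -/
noncomputable def sinSol (ω : ℂ) (x : ℝ) : ℂ :=
  if ω = 0 then (x : ℂ) else Complex.sin (ω * x) / ω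

theorem mul_sinSol (ω : ℂ) (x : ℝ) : ω * sinSol ω x = Complex.sin (ω * x) := by
  unfold sinSol
  split_ifs with h
  · simp [h]
  · field_simp

@[simp] theorem cosSol_zero (ω : ℂ) : cosSol ω 0 = 1 := by simp [cosSol]

@[simp] theorem sinSol_zero (ω : ℂ) : sinSol ω 0 = 0 := by simp [sinSol]

theorem cosSol_sq_add (ω : ℂ) (x : ℝ) : cosSol ω x ^ 2 + ω ^ 2 * sinSol ω x ^ 2 = 1 := by
  rw [← mul_pow, mul_sinSol, cosSol, add_comm, Complex.sin_sq_add_cos_sq]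

theorem hasDerivAt_cosSol (ω : ℂ) (x : ℝ) :
    HasDerivAt (cosSol ω) (-(ω ^ 2 * sinSol ω x)) x := by
  have h1 : HasDerivAt (fun x : ℝ => ω * (x : ℂ)) ω x := by
    simpa using (Complex.ofRealCLM.hasDerivAt (x := x)).const_mul ω
  have h2 := (Complex.hasDerivAt_cos (ω * x)).comp x h1
  rw [← mul_sinSol] at h2
  exact h2.congr_deriv (by ring)

theorem hasDerivAt_sinSol (ω : ℂ) (x : ℝ) : HasDerivAt (sinSol ω) (cosSol ω x) x := by
  by_cases h : ω = 0
  · have h1 : sinSol ω = fun x : ℝ => (x : ℂ) := by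
      funext y
      simp [sinSol, h]
    rw [h1, cosSol, h]
    simpa using (hasDerivAt_id x).ofReal_comp
  · have h0 : sinSol ω = fun x : ℝ => Complex.sin (ω * x) / ω := by
      funext y
      simp [sinSol, h]
    have h1 : HasDerivAt (fun x : ℝ => ω * (x : ℂ)) ω x := by
      simpa using (Complex.ofRealCLM.hasDerivAt (x := x)).const_mul ω
    have h2 := ((Complex.hasDerivAt_sin (ω * x)).comp x h1).div_const ω
    rw [h0]
    exact h2.congr_deriv (by rw [cosSol]; field_simp)

@[fun_prop] theorem continuous_cosSol (ω : ℂ) : Continuous (cosSol ω) :=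
  continuous_iff_continuousAt.2 fun x => (hasDerivAt_cosSol ω x).continuousAt

@[fun_prop] theorem continuous_sinSol (ω : ℂ) : Continuous (sinSol ω) :=
  continuous_iff_continuousAt.2 fun x => (hasDerivAt_sinSol ω x).continuousAt

theorem absolutelyContinuousOnInterval_primitive {d : ℝ → ℂ} {a b : ℝ}
    (hd : IntervalIntegrable d volume a b) :
    AbsolutelyContinuousOnInterval (fun x => ∫ t in a..x, d t) a b := by
  have h := hd.norm.absolutelyContinuousOnInterval_intervalIntegral (c := a) left_mem_uIcc
  rw [absolutelyContinuousOnInterval_iff] at h ⊢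
  intro ε hε
  obtain ⟨δ, hδ, H⟩ := h ε hε
  refine ⟨δ, hδ, fun E hE hlt => lt_of_le_of_lt (Finset.sum_le_sum fun i hi => ?_) (H E hE hlt)⟩
  have hmem := hE.1 i hi
  have hint : ∀ y ∈ uIcc a b, IntervalIntegrable d volume a y := fun y hy =>
    hd.mono_set (uIcc_subset_uIcc_left hy)
  rw [dist_eq_norm, dist_eq_norm, intervalIntegral.integral_interval_sub_left
    (hint _ hmem.1) (hint _ hmem.2), intervalIntegral.integral_interval_sub_left
    (hint _ hmem.1).norm (hint _ hmem.2).norm]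
  exact intervalIntegral.norm_integral_le_abs_integral_norm

/-- The product rule in integrated form. Since `d` is only integrable, `u` is differentiable only
almost everywhere; the difference of the two sides is absolutely continuous with derivative zero
almost everywhere, hence constant. -/
theorem mul_primitive_sub {ℓ : ℝ} {u d φ φ' : ℝ → ℂ} (hd : IntervalIntegrable d volume 0 ℓ)
    (hu : ∀ x ∈ Icc 0 ℓ, u x = u 0 + ∫ t in (0 : ℝ)..x, d t)
    (hφ : ∀ x, HasDerivAt φ (φ' x) x) (hφ' : Continuous φ') {x : ℝ} (hx : x ∈ Icc 0 ℓ) :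
    φ x * u x = φ 0 * u 0 + ∫ t in (0 : ℝ)..x, (φ' t * u t + φ t * d t) := by
  have hdx : IntervalIntegrable d volume 0 x :=
    hd.mono_set (uIcc_subset_uIcc_left (by rw [uIcc_of_le (hx.1.trans hx.2)]; exact hx))
  have hφc : Continuous φ := continuous_iff_continuousAt.2 fun x => (hφ x).continuousAt
  set U : ℝ → ℂ := fun x => u 0 + ∫ t in (0 : ℝ)..x, d t with hU
  have hPc : ContinuousOn (fun x => ∫ t in (0 : ℝ)..x, d t) (uIcc 0 x) :=
    intervalIntegral.continuousOn_primitive_interval' hdx left_mem_uIcc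
  have hUc : ContinuousOn U (uIcc 0 x) := continuousOn_const.add hPc
  have hI : IntervalIntegrable (fun t => φ' t * U t + φ t * d t) volume 0 x :=
    ((hφ'.continuousOn.mul hUc).intervalIntegrable).add (hdx.continuousOn_mul hφc.continuousOn)
  have hφ1 : AbsolutelyContinuousOnInterval φ 0 x := by
    refine ContDiffOn.absolutelyContinuousOnInterval (ContDiff.contDiffOn ?_)
    rw [contDiff_one_iff_deriv]
    refine ⟨fun x => (hφ x).differentiableAt, ?_⟩
    rwa [show deriv φ = φ' from funext fun x => (hφ x).deriv]
  have hconst : AbsolutelyContinuousOnInterval (fun _ : ℝ => u 0) 0 x :=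
    ContDiffOn.absolutelyContinuousOnInterval contDiffOn_const
  have hAC : AbsolutelyContinuousOnInterval
      (φ • (fun y => u 0 + ∫ t in (0 : ℝ)..y, d t) -
        fun y => ∫ t in (0 : ℝ)..y, (φ' t * U t + φ t * d t)) 0 x :=
    (hφ1.smul (hconst.add (absolutelyContinuousOnInterval_primitive hdx))).sub
      (absolutelyContinuousOnInterval_primitive hI)
  obtain ⟨C, hC⟩ := hAC.const_of_ae_hasDerivAt_zero (by
    filter_upwards [hdx.ae_hasDerivAt_integral, hI.ae_hasDerivAt_integral] with y h1 h2 hy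
    have e1 := (h1 hy 0 left_mem_uIcc).const_add (u 0)
    have e2 := h2 hy 0 left_mem_uIcc
    have e3 := ((hφ y).mul e1).sub e2
    refine e3.congr_deriv ?_
    simp only [hU]
    ring)
  have h0 := hC 0 left_mem_uIcc
  have h1 := hC x right_mem_uIcc
  simp only [Pi.sub_apply, Pi.mul_apply, smul_eq_mul, intervalIntegral.integral_same, add_zero,
    sub_zero] at h0 h1
  rw [hu x hx]
  have hcongr : ∫ t in (0 : ℝ)..x, (φ' t * u t + φ t * d t) =
      ∫ t in (0 : ℝ)..x, (φ' t * U t + φ t * d t) := by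
    refine intervalIntegral.integral_congr fun t ht => ?_
    rw [uIcc_of_le hx.1] at ht
    simp only [hU]
    rw [hu t ⟨ht.1, ht.2.trans hx.2⟩]
  rw [hcongr]
  linear_combination h1 - h0

/-- Variation of constants: the coefficient of `cosSol` in a solution of `-u'' = ω² u + f`. -/
noncomputable def cosCoef (ω a : ℂ) (f : ℝ → ℂ) (x : ℝ) : ℂ :=
  a + ∫ t in (0 : ℝ)..x, sinSol ω t * f t

/-- Variation of constants: the coefficient of `sinSol` in a solution of `-u'' = ω² u + f`. -/
noncomputable def sinCoef (ω b : ℂ) (f : ℝ → ℂ) (x : ℝ) : ℂ :=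
  b - ∫ t in (0 : ℝ)..x, cosSol ω t * f t

/-- The solution of `-u'' = ω² u + f` with `u 0 = a` and `u' 0 = b`. -/
noncomputable def cauchySol (ω a b : ℂ) (f : ℝ → ℂ) (x : ℝ) : ℂ :=
  cosSol ω x * cosCoef ω a f x + sinSol ω x * sinCoef ω b f x

/-- The derivative of `cauchySol`. -/
noncomputable def cauchySolDeriv (ω a b : ℂ) (f : ℝ → ℂ) (x : ℝ) : ℂ :=
  -(ω ^ 2 * sinSol ω x) * cosCoef ω a f x + cosSol ω x * sinCoef ω b f x

@[simp] theorem cauchySol_zero (ω a b : ℂ) (f : ℝ → ℂ) : cauchySol ω a b f 0 = a := by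
  simp [cauchySol, cosCoef]

@[simp] theorem cauchySolDeriv_zero (ω a b : ℂ) (f : ℝ → ℂ) : cauchySolDeriv ω a b f 0 = b := by
  simp [cauchySolDeriv, sinCoef]

theorem IsACRep.continuousOn {ℓ : ℝ} {u : ℝ → ℂ}
    {f d : Lp ℂ 2 (volume.restrict (Icc 0 ℓ))} (h : IsACRep ℓ u f d) (hℓ : 0 ≤ ℓ) :
    ContinuousOn u (Icc 0 ℓ) := by
  have h1 : ContinuousOn (fun x => u 0 + ∫ t in (0 : ℝ)..x, d t) (Icc 0 ℓ) := by
    have := intervalIntegral.continuousOn_primitive_interval'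
      (intervalIntegrable_of_Lp d ⟨hℓ, le_rfl⟩) left_mem_uIcc
    rw [uIcc_of_le hℓ] at this
    exact continuousOn_const.add this
  exact h1.congr h.eq_integral

/-- A function with `-u'' = ω² u + f` is given by variation of constants. -/
theorem IsACRep.eq_cauchySol {ℓ : ℝ} {u v : ℝ → ℂ} {ω : ℂ}
    {w w' g f : Lp ℂ 2 (volume.restrict (Icc 0 ℓ))}
    (hu : IsACRep ℓ u w w') (hv : IsACRep ℓ v w' g) (hf : g = -f - ω ^ 2 • w) {x : ℝ}
    (hx : x ∈ Icc 0 ℓ) :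
    u x = cauchySol ω (u 0) (v 0) f x ∧ v x = cauchySolDeriv ω (u 0) (v 0) f x := by
  have hℓ : 0 ≤ ℓ := hx.1.trans hx.2
  have hi : ∀ d : Lp ℂ 2 (volume.restrict (Icc 0 ℓ)), IntervalIntegrable d volume 0 ℓ :=
    fun d => intervalIntegrable_of_Lp d ⟨hℓ, le_rfl⟩
  have hg : ∀ᵐ t ∂(volume.restrict (Icc 0 ℓ)), g t = -f t - ω ^ 2 * u t := by
    rw [hf]
    filter_upwards [Lp.coeFn_sub (-f) (ω ^ 2 • w), Lp.coeFn_neg f, Lp.coeFn_smul (ω ^ 2) w,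
      hu.ae_eq] with t h1 h2 h3 h4
    rw [h1, Pi.sub_apply, h2, h3, Pi.neg_apply, Pi.smul_apply, h4, smul_eq_mul]
  have hdc := hasDerivAt_cosSol ω
  have hds := hasDerivAt_sinSol ω
  have hdz : ∀ x, HasDerivAt (fun x => ω ^ 2 * sinSol ω x) (ω ^ 2 * cosSol ω x) x :=
    fun x => (hds x).const_mul _
  have m1 := mul_primitive_sub (hi w') hu.eq_integral hdc (by fun_prop) hx
  have m2 := mul_primitive_sub (hi g) hv.eq_integral hds (by fun_prop) hx
  have m3 := mul_primitive_sub (hi w') hu.eq_integral hdz (by fun_prop) hx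
  have m4 := mul_primitive_sub (hi g) hv.eq_integral hdc (by fun_prop) hx
  have hsub : ∀ {d : ℝ → ℂ}, IntervalIntegrable d volume 0 ℓ → IntervalIntegrable d volume 0 x :=
    fun h => h.mono_set (uIcc_subset_uIcc_left (by rw [uIcc_of_le hℓ]; exact hx))
  have hcu : ContinuousOn u (uIcc 0 ℓ) := by
    rw [uIcc_of_le hℓ]; exact hu.continuousOn hℓ
  have hcv : ContinuousOn v (uIcc 0 ℓ) := by
    rw [uIcc_of_le hℓ]; exact hv.continuousOn hℓ
  have hint : ∀ {φ ψ y : ℝ → ℂ} {d : Lp ℂ 2 (volume.restrict (Icc 0 ℓ))}, Continuous φ →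
      Continuous ψ → ContinuousOn y (uIcc 0 ℓ) →
      IntervalIntegrable (fun t => φ t * y t + ψ t * d t) volume 0 x := by
    intro φ ψ y d hφ hψ hy
    exact hsub (((hφ.continuousOn.mul hy).intervalIntegrable).add
      ((hi d).continuousOn_mul hψ.continuousOn))
  -- The combinations in `e1` and `e2` have derivatives `sinSol * f` and `-cosSol * f`;
  -- `cosSol_sq_add` then inverts the system for `u` and `v`.
  have e1 : cosSol ω x * u x - sinSol ω x * v x = cosCoef ω (u 0) f x := by
    rw [m1, m2, cosCoef, cosSol_zero, sinSol_zero, one_mul, zero_mul, zero_add, add_sub_assoc,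
      ← intervalIntegral.integral_sub (hint (by fun_prop) (by fun_prop) hcu)
        (hint (by fun_prop) (by fun_prop) hcv)]
    congr 1
    refine integral_congr_Lp hx ?_
    filter_upwards [hg, hu.ae_eq, hv.ae_eq] with t h1 h2 h3
    rw [h1, h3]
    ring
  have e2 : ω ^ 2 * sinSol ω x * u x + cosSol ω x * v x = sinCoef ω (v 0) f x := by
    rw [m3, m4, sinCoef, cosSol_zero, sinSol_zero, one_mul, mul_zero, zero_mul, zero_add,
      add_left_comm, ← intervalIntegral.integral_add (hint (by fun_prop) (by fun_prop) hcu)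
        (hint (by fun_prop) (by fun_prop) hcv), sub_eq_add_neg, ← intervalIntegral.integral_neg]
    congr 1
    refine integral_congr_Lp hx ?_
    filter_upwards [hg, hu.ae_eq, hv.ae_eq] with t h1 h2 h3
    rw [h1, h3]
    ring
  rw [cauchySol, cauchySolDeriv, ← e1, ← e2]
  constructor
  · linear_combination -u x * cosSol_sq_add ω x
  · linear_combination -v x * cosSol_sq_add ω x

/-- The converse of `IsACRep.eq_cauchySol`. Differentiating the coefficients contributes nothing to
the first derivative, and `-f` to the second by `cosSol_sq_add`. -/
theorem isACRep_cauchySol {ℓ : ℝ} {ω a b : ℂ} {w w' f : Lp ℂ 2 (volume.restrict (Icc 0 ℓ))}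
    (hw : w =ᵐ[volume.restrict (Icc 0 ℓ)] cauchySol ω a b f)
    (hw' : w' =ᵐ[volume.restrict (Icc 0 ℓ)] cauchySolDeriv ω a b f) :
    IsACRep ℓ (cauchySol ω a b f) w w' ∧
      IsACRep ℓ (cauchySolDeriv ω a b f) w' (-f - ω ^ 2 • w) := by
  have main : ∀ x ∈ Icc 0 ℓ,
      cauchySol ω a b f x = a + ∫ t in (0 : ℝ)..x, cauchySolDeriv ω a b f t ∧
      cauchySolDeriv ω a b f x =
        b + ∫ t in (0 : ℝ)..x, (-f t - ω ^ 2 * cauchySol ω a b f t) := by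
    intro x hx
    have hℓ : 0 ≤ ℓ := hx.1.trans hx.2
    have hi : IntervalIntegrable f volume 0 ℓ := intervalIntegrable_of_Lp f ⟨hℓ, le_rfl⟩
    have hsub : ∀ {d : ℝ → ℂ}, IntervalIntegrable d volume 0 ℓ →
        IntervalIntegrable d volume 0 x :=
      fun h => h.mono_set (uIcc_subset_uIcc_left (by rw [uIcc_of_le hℓ]; exact hx))
    have i1 : IntervalIntegrable (fun t => sinSol ω t * f t) volume 0 ℓ :=
      hi.continuousOn_mul (continuous_sinSol ω).continuousOn
    have i2 : IntervalIntegrable (fun t => -(cosSol ω t * f t)) volume 0 ℓ :=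
      (hi.continuousOn_mul (continuous_cosSol ω).continuousOn).neg
    have hA : ∀ x ∈ Icc 0 ℓ, cosCoef ω a f x =
        cosCoef ω a f 0 + ∫ t in (0 : ℝ)..x, sinSol ω t * f t := by
      intro x _
      simp [cosCoef]
    have hB : ∀ x ∈ Icc 0 ℓ, sinCoef ω b f x =
        sinCoef ω b f 0 + ∫ t in (0 : ℝ)..x, -(cosSol ω t * f t) := by
      intro x _
      simp [sinCoef, sub_eq_add_neg]
    have hcA : ContinuousOn (cosCoef ω a f) (uIcc 0 ℓ) :=
      continuousOn_const.add (intervalIntegral.continuousOn_primitive_interval' i1 left_mem_uIcc)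
    have hcB : ContinuousOn (sinCoef ω b f) (uIcc 0 ℓ) :=
      continuousOn_const.sub (intervalIntegral.continuousOn_primitive_interval'
        (hi.continuousOn_mul (continuous_cosSol ω).continuousOn) left_mem_uIcc)
    have hdc := hasDerivAt_cosSol ω
    have hds := hasDerivAt_sinSol ω
    have hdz : ∀ x, HasDerivAt (fun x => -(ω ^ 2 * sinSol ω x)) (-(ω ^ 2 * cosSol ω x)) x :=
      fun x => ((hds x).const_mul _).neg
    have m1 := mul_primitive_sub i1 hA hdc (by fun_prop) hx
    have m2 := mul_primitive_sub i2 hB hds (by fun_prop) hx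
    have m3 := mul_primitive_sub i1 hA hdz (by fun_prop) hx
    have m4 := mul_primitive_sub i2 hB hdc (by fun_prop) hx
    have hint : ∀ {φ ψ y d : ℝ → ℂ}, Continuous φ → Continuous ψ → ContinuousOn y (uIcc 0 ℓ) →
        IntervalIntegrable d volume 0 ℓ →
        IntervalIntegrable (fun t => φ t * y t + ψ t * d t) volume 0 x := by
      intro φ ψ y d hφ hψ hy hd
      exact hsub (((hφ.continuousOn.mul hy).intervalIntegrable).add
        (hd.continuousOn_mul hψ.continuousOn))
    constructor
    · rw [cauchySol, m1, m2, add_add_add_comm,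
        ← intervalIntegral.integral_add (hint (by fun_prop) (by fun_prop) hcA i1)
          (hint (by fun_prop) (by fun_prop) hcB i2)]
      congr 1
      · simp [cosCoef]
      · refine intervalIntegral.integral_congr fun t _ => ?_
        simp only [cauchySolDeriv]
        ring
    · rw [cauchySolDeriv, m3, m4, add_add_add_comm,
        ← intervalIntegral.integral_add (hint (by fun_prop) (by fun_prop) hcA i1)
          (hint (by fun_prop) (by fun_prop) hcB i2)]
      congr 1
      · simp [sinCoef]
      · refine intervalIntegral.integral_congr fun t _ => ?_
        simp only [cauchySol]
        linear_combination -f t * cosSol_sq_add ω t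
  refine ⟨⟨hw, fun x hx => ?_⟩, ⟨hw', fun x hx => ?_⟩⟩
  · rw [(main x hx).1, cauchySol_zero, integral_congr_Lp hx hw']
  · rw [(main x hx).2, cauchySolDeriv_zero]
    congr 1
    refine (integral_congr_Lp hx ?_).symm
    filter_upwards [Lp.coeFn_sub (-f) (ω ^ 2 • w), Lp.coeFn_neg f, Lp.coeFn_smul (ω ^ 2) w,
      hw] with t h1 h2 h3 h4
    rw [h1, Pi.sub_apply, h2, h3, Pi.neg_apply, Pi.smul_apply, h4, smul_eq_mul]

/-! ### Bounded functionals and operators on one edge. -/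

/-- On a bounded interval the `L¹` norm is bounded by the `L²` norm. -/
theorem exists_integral_norm_le (ℓ : ℝ) : ∃ C, 0 ≤ C ∧
    ∀ f : Lp ℂ 2 (volume.restrict (Icc (0 : ℝ) ℓ)), ∫ t in Icc 0 ℓ, ‖f t‖ ≤ C * ‖f‖ := by
  refine ⟨((volume.restrict (Icc 0 ℓ)) univ ^ (1 / (1 : ENNReal).toReal -
    1 / (2 : ENNReal).toReal)).toReal, ENNReal.toReal_nonneg, fun f => ?_⟩
  have h1 := eLpNorm_le_eLpNorm_mul_rpow_measure_univ (μ := volume.restrict (Icc (0 : ℝ) ℓ))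
    (p := 1) (q := 2) (by norm_num) (Lp.aestronglyMeasurable f)
  rw [integral_norm_eq_lintegral_enorm (Lp.aestronglyMeasurable f), ← eLpNorm_one_eq_lintegral_enorm,
    Lp.norm_def, mul_comm, ← ENNReal.toReal_mul]
  refine ENNReal.toReal_mono ?_ h1
  refine ENNReal.mul_ne_top (Lp.eLpNorm_ne_top f) (ENNReal.rpow_ne_top_of_nonneg (by norm_num) ?_)
  simp

theorem norm_integral_mul_le {ℓ C : ℝ} {θ : ℝ → ℂ} (hC : ∀ t ∈ Icc 0 ℓ, ‖θ t‖ ≤ C)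
    (f : Lp ℂ 2 (volume.restrict (Icc (0 : ℝ) ℓ))) {x : ℝ} (hx : x ∈ Icc 0 ℓ) :
    ‖∫ t in (0 : ℝ)..x, θ t * f t‖ ≤ C * ∫ t in Icc 0 ℓ, ‖f t‖ := by
  have hint : IntegrableOn (fun t => C * ‖f t‖) (Icc 0 ℓ) :=
    (((Lp.memLp f).integrable (by norm_num)).norm).const_mul C
  rw [← integral_const_mul]
  have hC0 : 0 ≤ C := (norm_nonneg _).trans (hC x hx)
  refine (intervalIntegral.norm_integral_le_of_norm_le hx.1 (g := fun t => C * ‖f t‖)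
    (ae_of_all _ fun t ht => ?_) ?_).trans ?_
  · rw [norm_mul]
    exact mul_le_mul_of_nonneg_right (hC t ⟨ht.1.le, ht.2.trans hx.2⟩) (norm_nonneg _)
  · exact (intervalIntegrable_iff_integrableOn_Icc_of_le hx.1).2
      (hint.mono_set (Icc_subset_Icc_right hx.2))
  · rw [intervalIntegral.integral_of_le hx.1]
    refine setIntegral_mono_set hint (ae_of_all _ fun t => by positivity) ?_
    exact (Ioc_subset_Icc_self.trans (Icc_subset_Icc_right hx.2)).eventuallyLE

/-- The trace inequality `|u 0| ≤ C (‖u‖ + ‖u'‖)`. -/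
theorem exists_trace_bound {ℓ : ℝ} (hℓ : 0 < ℓ) : ∃ C, 0 ≤ C ∧
    ∀ (u : ℝ → ℂ) (f d : Lp ℂ 2 (volume.restrict (Icc 0 ℓ))), IsACRep ℓ u f d →
      ‖u 0‖ ≤ C * (‖f‖ + ‖d‖) := by
  obtain ⟨C, hC0, hC⟩ := exists_integral_norm_le ℓ
  refine ⟨C / ℓ + C, by positivity, fun u f d h => ?_⟩
  have hfi : IntegrableOn (fun t => ‖f t‖) (Icc 0 ℓ) :=
    ((Lp.memLp f).integrable (by norm_num)).norm
  -- Integrating `u 0 = u x - ∫₀ˣ d` over the edge replaces the point value by `L²` norms.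
  have h1 : ∫ _ in Icc 0 ℓ, ‖u 0‖ ≤ ∫ t in Icc 0 ℓ, (‖f t‖ + C * ‖d‖) := by
    refine integral_mono_ae (integrable_const _) (hfi.add (integrable_const _)) ?_
    filter_upwards [h.ae_eq, ae_restrict_mem measurableSet_Icc] with x hx hxI
    have e1 := h.eq_integral x hxI
    have e2 := norm_integral_mul_le (θ := fun _ => 1) (C := 1) (by simp) d hxI
    simp only [one_mul] at e2
    rw [hx]
    calc ‖u 0‖ = ‖u x - ∫ t in (0 : ℝ)..x, d t‖ := by rw [e1]; congr 1; ring
      _ ≤ ‖u x‖ + ‖∫ t in (0 : ℝ)..x, d t‖ := norm_sub_le _ _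
      _ ≤ ‖u x‖ + C * ‖d‖ := by gcongr; exact e2.trans (hC d)
  rw [integral_add hfi (integrable_const _)] at h1
  simp only [setIntegral_const, Real.volume_real_Icc_of_le hℓ.le, sub_zero, smul_eq_mul] at h1
  have h2 := hC f
  have h3 : ‖u 0‖ ≤ C / ℓ * ‖f‖ + C * ‖d‖ := by
    rw [← mul_le_mul_iff_right₀ hℓ]
    refine h1.trans ?_
    have e : ℓ * (C / ℓ * ‖f‖) = C * ‖f‖ := by field_simp
    rw [mul_add, e]
    gcongr
  have h4 : 0 ≤ C / ℓ * ‖d‖ := by positivity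
  have h5 : 0 ≤ C * ‖f‖ := by positivity
  linarith

theorem memLp_of_continuousOn {ℓ : ℝ} {φ : ℝ → ℂ} (hφ : ContinuousOn φ (Icc 0 ℓ)) :
    MemLp φ 2 (volume.restrict (Icc 0 ℓ)) := by
  obtain ⟨C, hC⟩ := isCompact_Icc.exists_bound_of_continuousOn hφ
  refine MemLp.of_bound (hφ.aestronglyMeasurable measurableSet_Icc) C ?_
  filter_upwards [ae_restrict_mem measurableSet_Icc] with x hx using hC x hx

/-- The Volterra operators `f ↦ φ ∫₀ˣ θ f` are bounded on `L²`. -/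
theorem exists_volterra (ℓ : ℝ) {φ θ : ℝ → ℂ} (hφ : Continuous φ) (hθ : Continuous θ) :
    ∃ K : Lp ℂ 2 (volume.restrict (Icc (0 : ℝ) ℓ)) →L[ℂ] Lp ℂ 2 (volume.restrict (Icc 0 ℓ)),
      ∀ f, K f =ᵐ[volume.restrict (Icc 0 ℓ)] fun x => φ x * ∫ t in (0 : ℝ)..x, θ t * f t := by
  obtain ⟨C, hC0, hC⟩ := exists_integral_norm_le ℓ
  obtain ⟨A, hA⟩ := isCompact_Icc.exists_bound_of_continuousOn (hφ.continuousOn (s := Icc 0 ℓ))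
  obtain ⟨B, hB⟩ := isCompact_Icc.exists_bound_of_continuousOn (hθ.continuousOn (s := Icc 0 ℓ))
  have hi : ∀ (f : Lp ℂ 2 (volume.restrict (Icc (0 : ℝ) ℓ))) {x}, x ∈ Icc 0 ℓ →
      IntervalIntegrable (fun t => θ t * f t) volume 0 x := fun f x hx =>
    (intervalIntegrable_of_Lp f hx).continuousOn_mul hθ.continuousOn
  have hmem : ∀ f : Lp ℂ 2 (volume.restrict (Icc (0 : ℝ) ℓ)),
      MemLp (fun x => φ x * ∫ t in (0 : ℝ)..x, θ t * f t) 2 (volume.restrict (Icc 0 ℓ)) := by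
    intro f
    refine memLp_of_continuousOn (hφ.continuousOn.mul ?_)
    rcases le_or_gt 0 ℓ with h | h
    · have := intervalIntegral.continuousOn_primitive_interval'
        (hi f ⟨h, le_rfl⟩) left_mem_uIcc
      rwa [uIcc_of_le h] at this
    · simp [Icc_eq_empty_of_lt h]
  have hbound : ∀ f : Lp ℂ 2 (volume.restrict (Icc (0 : ℝ) ℓ)), ∀ x ∈ Icc 0 ℓ,
      ‖φ x * ∫ t in (0 : ℝ)..x, θ t * f t‖ ≤ |A| * (|B| * (C * ‖f‖)) := by
    intro f x hx
    rw [norm_mul]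
    gcongr
    · exact (hA x hx).trans (le_abs_self _)
    · refine (norm_integral_mul_le (C := |B|) (fun t ht => (hB t ht).trans (le_abs_self _))
        f hx).trans ?_
      gcongr
      exact hC f
  let K₀ : Lp ℂ 2 (volume.restrict (Icc (0 : ℝ) ℓ)) →ₗ[ℂ] Lp ℂ 2 (volume.restrict (Icc 0 ℓ)) :=
    { toFun := fun f => (hmem f).toLp
      map_add' := fun f g => by
        rw [← MemLp.toLp_add]
        refine MemLp.toLp_congr _ _ ?_
        filter_upwards [ae_restrict_mem measurableSet_Icc] with x hx
        have : ∫ t in (0 : ℝ)..x, θ t * (f + g) t =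
            ∫ t in (0 : ℝ)..x, (θ t * f t + θ t * g t) := by
          refine integral_congr_Lp hx ?_
          filter_upwards [Lp.coeFn_add f g] with t ht
          rw [ht, Pi.add_apply, mul_add]
        rw [this, intervalIntegral.integral_add (hi f hx) (hi g hx), mul_add, Pi.add_apply]
      map_smul' := fun c f => by
        rw [RingHom.id_apply, ← MemLp.toLp_const_smul]
        refine MemLp.toLp_congr _ _ ?_
        filter_upwards [ae_restrict_mem measurableSet_Icc] with x hx
        have : ∫ t in (0 : ℝ)..x, θ t * (c • f) t = ∫ t in (0 : ℝ)..x, c * (θ t * f t) := by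
          refine integral_congr_Lp hx ?_
          filter_upwards [Lp.coeFn_smul c f] with t ht
          rw [ht, Pi.smul_apply, smul_eq_mul]
          ring
        rw [this, intervalIntegral.integral_const_mul, Pi.smul_apply, smul_eq_mul]
        ring }
  have hK : ∀ f, ‖K₀ f‖ ≤ (((volume.restrict (Icc 0 ℓ)) univ).toReal ^ (2 : ENNReal).toReal⁻¹ *
      (|A| * (|B| * C))) * ‖f‖ := by
    intro f
    have h1 := Lp.norm_le_of_ae_bound (f := K₀ f) (C := |A| * (|B| * (C * ‖f‖))) (by positivity) (by
      filter_upwards [(hmem f).coeFn_toLp, ae_restrict_mem measurableSet_Icc] with x hx hxI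
      change ‖MemLp.toLp _ (hmem f) x‖ ≤ _
      rw [hx]
      exact hbound f x hxI)
    refine h1.trans (le_of_eq ?_)
    simp only [measureUnivNNReal, ENNReal.toReal]
    push_cast
    ring
  exact ⟨K₀.mkContinuous _ hK, fun f => (hmem f).coeFn_toLp⟩

/-- The functional `f ↦ ∫₀^ℓ θ f` is bounded on `L²`. -/
theorem exists_integral_functional {ℓ : ℝ} (hℓ : 0 ≤ ℓ) {θ : ℝ → ℂ} (hθ : Continuous θ) :
    ∃ K : Lp ℂ 2 (volume.restrict (Icc (0 : ℝ) ℓ)) →L[ℂ] ℂ,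
      ∀ f, K f = ∫ t in (0 : ℝ)..ℓ, θ t * f t := by
  have hmem : MemLp (fun t => (starRingEnd ℂ) (θ t)) 2 (volume.restrict (Icc 0 ℓ)) :=
    memLp_of_continuousOn (Complex.continuous_conj.comp hθ).continuousOn
  refine ⟨innerSL ℂ hmem.toLp, fun f => ?_⟩
  rw [innerSL_apply_apply, L2.inner_def, intervalIntegral.integral_of_le hℓ,
    ← integral_Icc_eq_integral_Ioc]
  refine integral_congr_ae ?_
  filter_upwards [hmem.coeFn_toLp] with t ht
  rw [ht, RCLike.inner_apply, Complex.conj_conj, mul_comm]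

/-- Bounded operators which build functions on an edge from the data `a`, `b`, `f`. -/
theorem exists_edge_synthesis (ℓ : ℝ) (ω : ℂ) {φ ψ : ℝ → ℂ} (hφ : Continuous φ)
    (hψ : Continuous ψ) :
    ∃ (S T : ℂ →L[ℂ] Lp ℂ 2 (volume.restrict (Icc (0 : ℝ) ℓ)))
      (K : Lp ℂ 2 (volume.restrict (Icc (0 : ℝ) ℓ)) →L[ℂ] Lp ℂ 2 (volume.restrict (Icc 0 ℓ))),
      ∀ a b f, (S a + T b + K f : Lp ℂ 2 (volume.restrict (Icc (0 : ℝ) ℓ)))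
        =ᵐ[volume.restrict (Icc 0 ℓ)]
        fun x => φ x * cosCoef ω a f x + ψ x * sinCoef ω b f x := by
  obtain ⟨K₁, hK₁⟩ := exists_volterra ℓ hφ (continuous_sinSol ω)
  obtain ⟨K₂, hK₂⟩ := exists_volterra ℓ hψ (continuous_cosSol ω)
  have m1 := memLp_of_continuousOn (hφ.continuousOn (s := Icc 0 ℓ))
  have m2 := memLp_of_continuousOn (hψ.continuousOn (s := Icc 0 ℓ))
  refine ⟨ContinuousLinearMap.toSpanSingleton ℂ m1.toLp,
    ContinuousLinearMap.toSpanSingleton ℂ m2.toLp, K₁ - K₂, fun a b f => ?_⟩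
  simp only [ContinuousLinearMap.toSpanSingleton_apply, sub_apply]
  filter_upwards [Lp.coeFn_add (a • m1.toLp + b • m2.toLp) (K₁ f - K₂ f),
    Lp.coeFn_add (a • m1.toLp) (b • m2.toLp), Lp.coeFn_smul a m1.toLp, Lp.coeFn_smul b m2.toLp,
    Lp.coeFn_sub (K₁ f) (K₂ f), hK₁ f, hK₂ f, m1.coeFn_toLp, m2.coeFn_toLp]
    with x h1 h2 h3 h4 h5 h6 h7 h8 h9
  rw [h1, Pi.add_apply, h2, Pi.add_apply, h3, h4, h5, Pi.sub_apply, h6, h7, Pi.smul_apply,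
    Pi.smul_apply, h8, h9, cosCoef, sinCoef, smul_eq_mul, smul_eq_mul]
  ring

/-! ### The operator in terms of Cauchy data at the left ends of the edges. -/

theorem exists_laplacian_apply {L : ℝ} {w g : L2Graph L} (h : IsLaplacian L w g) :
    ∃ hw : w ∈ (-laplacian L).domain, (-laplacian L) ⟨w, hw⟩ = -g := by
  have h1 : (w, g) ∈ (laplacian L).graph := by
    rw [laplacian_graph]
    exact h
  obtain ⟨y, hy1, hy2⟩ := (LinearPMap.mem_graph_iff _).1 h1
  dsimp only at hy1 hy2
  subst hy1
  exact ⟨y.2, by rw [LinearPMap.neg_apply]; exact congrArg Neg.neg hy2⟩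

theorem isLaplacian_coe {L : ℝ} (w : (-laplacian L).domain) :
    IsLaplacian L w (-((-laplacian L) w)) := by
  have h1 : ((w : L2Graph L), laplacian L ⟨w, w.2⟩) ∈ (laplacian L).graph :=
    LinearPMap.mem_graph (laplacian L) ⟨w, w.2⟩
  rw [laplacian_graph] at h1
  rw [LinearPMap.neg_apply, neg_neg]
  exact h1

theorem mem_eigenspace_iff {L : ℝ} {z : ℂ} {w : L2Graph L} :
    w ∈ eigenspace (-laplacian L) z ↔ IsLaplacian L w (-(z • w)) := by
  rw [eigenspace, Submodule.mem_map]
  constructor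
  · rintro ⟨x, hx, rfl⟩
    have h1 : (-laplacian L) x = z • (x : L2Graph L) := sub_eq_zero.1 hx
    have h2 := isLaplacian_coe x
    rwa [h1] at h2
  · intro h
    obtain ⟨hw, h1⟩ := exists_laplacian_apply h
    refine ⟨⟨w, hw⟩, ?_, rfl⟩
    rw [neg_neg] at h1
    exact sub_eq_zero.2 h1

theorem edgeLength_pos {L : ℝ} (hL : 0 < L) (e : Edge) : 0 < edgeLength L e := by
  rcases e with ⟨n, _ | _ | _⟩
  exacts [hL, Real.pi_pos, Real.pi_pos]

/-- `IsLaplacian L w g`, where `a e` and `b e` are the values of `w` and `∂ₓ w` at the left end of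
the edge `e`. -/
def HasCauchyData (L : ℝ) (w g : L2Graph L) (a b : Edge → ℂ) : Prop :=
  ∃ (w' : L2Graph L) (u v : Edge → ℝ → ℂ),
    (∀ e, IsACRep (edgeLength L e) (u e) (w e) (w' e)) ∧
    (∀ e, IsACRep (edgeLength L e) (v e) (w' e) (g e)) ∧
    IsContinuousAtVertices L u ∧ IsKirchhoff L v ∧ (∀ e, u e 0 = a e) ∧ (∀ e, v e 0 = b e)

theorem isLaplacian_iff_exists_hasCauchyData {L : ℝ} {w g : L2Graph L} :
    IsLaplacian L w g ↔ ∃ a b, HasCauchyData L w g a b := by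
  constructor
  · rintro ⟨w', u, v, hu, hv, hc, hk⟩
    exact ⟨fun e => u e 0, fun e => v e 0, w', u, v, hu, hv, hc, hk, fun _ => rfl, fun _ => rfl⟩
  · rintro ⟨a, b, w', u, v, hu, hv, hc, hk, -, -⟩
    exact ⟨w', u, v, hu, hv, hc, hk⟩

/-- The value at the right end of an edge of the solution of `-u'' = ω² u + f` with Cauchy data
`a`, `b`. -/
noncomputable def rightValue (L : ℝ) (ω : ℂ) (f : L2Graph L) (a b : Edge → ℂ) (e : Edge) : ℂ :=
  cauchySol ω (a e) (b e) (f e) (edgeLength L e)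

/-- The derivative at the right end of an edge of the solution of `-u'' = ω² u + f` with Cauchy
data `a`, `b`. -/
noncomputable def rightDeriv (L : ℝ) (ω : ℂ) (f : L2Graph L) (a b : Edge → ℂ) (e : Edge) : ℂ :=
  cauchySolDeriv ω (a e) (b e) (f e) (edgeLength L e)

/-- The vertex conditions, expressed through the Cauchy data at the left ends of the edges. -/
structure VertexConditions (L : ℝ) (ω : ℂ) (f : L2Graph L) (a b : Edge → ℂ) : Prop where
  left_upper : ∀ n : ℤ, rightValue L ω f a b (n, .link) = a (n, .upper)
  left_lower : ∀ n : ℤ, rightValue L ω f a b (n, .link) = a (n, .lower)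
  right_upper : ∀ n : ℤ, a (n + 1, .link) = rightValue L ω f a b (n, .upper)
  right_lower : ∀ n : ℤ, a (n + 1, .link) = rightValue L ω f a b (n, .lower)
  kirchhoff_left : ∀ n : ℤ,
    rightDeriv L ω f a b (n, .link) = b (n, .upper) + b (n, .lower)
  kirchhoff_right : ∀ n : ℤ,
    b (n + 1, .link) = rightDeriv L ω f a b (n, .upper) + rightDeriv L ω f a b (n, .lower)

theorem HasCauchyData.vertexConditions {L : ℝ} (hL : 0 < L) {ω : ℂ} {w g f : L2Graph L}
    {a b : Edge → ℂ} (h : HasCauchyData L w g a b) (hf : g = -f - ω ^ 2 • w) :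
    VertexConditions L ω f a b := by
  obtain ⟨w', u, v, hu, hv, hc, hk, ha, hb⟩ := h
  have key : ∀ e, u e (edgeLength L e) = rightValue L ω f a b e ∧
      v e (edgeLength L e) = rightDeriv L ω f a b e := by
    intro e
    have hfe : g e = -(f e) - ω ^ 2 • w e := by rw [hf]; rfl
    rw [rightValue, rightDeriv, ← ha, ← hb]
    exact (hu e).eq_cauchySol (hv e) hfe ⟨(edgeLength_pos hL e).le, le_rfl⟩
  refine ⟨fun n => ?_, fun n => ?_, fun n => ?_, fun n => ?_, fun n => ?_, fun n => ?_⟩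
  · rw [← (key _).1, ← ha]; exact hc.left_upper n
  · rw [← (key _).1, ← ha]; exact hc.left_lower n
  · rw [← (key _).1, ← ha]; exact hc.right_upper n
  · rw [← (key _).1, ← ha]; exact hc.right_lower n
  · rw [← (key _).2, ← hb, ← hb]; exact hk.left n
  · rw [← (key _).2, ← (key _).2, ← hb]; exact hk.right n

theorem HasCauchyData.eq_zero {L : ℝ} {ω : ℂ} {w g : L2Graph L}
    (h : HasCauchyData L w g 0 0) (hg : g = -(ω ^ 2 • w)) : w = 0 := by
  obtain ⟨w', u, v, hu, hv, -, -, ha, hb⟩ := h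
  ext1
  funext e
  have hge : g e = -(0 : Lp ℂ 2 (edgeMeasure L e)) - ω ^ 2 • w e := by
    rw [hg, neg_zero, zero_sub]; rfl
  change w e = 0
  rw [Lp.eq_zero_iff_ae_eq_zero]
  filter_upwards [(hu e).ae_eq, ae_restrict_mem measurableSet_Icc] with x h1 h2
  rw [h1, ((hu e).eq_cauchySol (hv e) hge h2).1, ha, hb]
  have hz := Lp.coeFn_zero ℂ 2 (edgeMeasure L e)
  have i1 : ∫ t in (0 : ℝ)..x, sinSol ω t * (0 : Lp ℂ 2 (edgeMeasure L e)) t = 0 := by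
    rw [integral_congr_Lp (g := fun _ => 0) h2, intervalIntegral.integral_zero]
    filter_upwards [hz] with t ht
    rw [ht, Pi.zero_apply, mul_zero]
  have i2 : ∫ t in (0 : ℝ)..x, cosSol ω t * (0 : Lp ℂ 2 (edgeMeasure L e)) t = 0 := by
    rw [integral_congr_Lp (g := fun _ => 0) h2, intervalIntegral.integral_zero]
    filter_upwards [hz] with t ht
    rw [ht, Pi.zero_apply, mul_zero]
  rw [cauchySol, cosCoef, sinCoef, i1, i2]
  simp

theorem tendsto_norm_cofinite {L : ℝ} (w : L2Graph L) (k : EdgeKind) :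
    Tendsto (fun n : ℤ => ‖w (n, k)‖) cofinite (nhds 0) := by
  have h1 := ((lp.memℓp w).summable (by norm_num)).tendsto_cofinite_zero
  simp only [ENNReal.toReal_ofNat, Real.rpow_ofNat] at h1
  have h2 := (Real.continuous_sqrt.tendsto 0).comp h1
  have h3 : Function.Injective fun n : ℤ => ((n, k) : Edge) := fun a b h => congrArg Prod.fst h
  have h4 := h2.comp h3.tendsto_cofinite
  simpa [Function.comp_def] using h4

/-- The Cauchy data at the links tend to zero. -/
theorem HasCauchyData.tendsto {L : ℝ} (hL : 0 < L) {w g : L2Graph L} {a b : Edge → ℂ}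
    (h : HasCauchyData L w g a b) :
    Tendsto (fun n : ℤ => a (n, .link)) cofinite (nhds 0) ∧
      Tendsto (fun n : ℤ => b (n, .link)) cofinite (nhds 0) := by
  obtain ⟨w', u, v, hu, hv, -, -, ha, hb⟩ := h
  obtain ⟨C, hC0, hC⟩ := exists_trace_bound hL
  constructor
  · have h1 := ((tendsto_norm_cofinite w .link).add (tendsto_norm_cofinite w' .link)).const_mul C
    rw [add_zero, mul_zero] at h1
    exact squeeze_zero_norm (fun n => by rw [← ha]; exact hC _ _ _ (hu (n, .link))) h1
  · have h1 := ((tendsto_norm_cofinite w' .link).add (tendsto_norm_cofinite g .link)).const_mul C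
    rw [add_zero, mul_zero] at h1
    exact squeeze_zero_norm (fun n => by rw [← hb]; exact hC _ _ _ (hv (n, .link))) h1

/-- Used contrapositively: nonzero slopes certify that an eigenfunction built from its data is not
zero. -/
theorem HasCauchyData.deriv_eq_zero {L : ℝ} (hL : 0 < L) {g : L2Graph L} {a b : Edge → ℂ}
    (h : HasCauchyData L 0 g a b) (e : Edge) : b e = 0 := by
  obtain ⟨w', u, v, hu, hv, -, -, ha, hb⟩ := h
  obtain ⟨C, hC0, hC⟩ := exists_trace_bound (edgeLength_pos hL e)
  have h1 : w' e = 0 := (hu e).derivative_eq_zero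
  have h2 := hv e
  rw [h1] at h2
  have h3 := hC _ _ _ h2
  rw [h2.derivative_eq_zero, norm_zero, add_zero, mul_zero] at h3
  rw [← hb]
  exact norm_le_zero_iff.1 h3

/-! ### Assembling edgewise operators on the graph. -/

theorem encard_kind_fiber_le (i : ℤ) : ((Prod.fst : Edge → ℤ) ⁻¹' {i}).encard ≤ (3 : ℕ) := by
  have h : (Prod.fst : Edge → ℤ) ⁻¹' {i} ⊆ {(i, .link), (i, .upper), (i, .lower)} := by
    rintro ⟨n, _ | _ | _⟩ hn
    all_goals
      have : n = i := hn
      simp [this]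
  refine (Set.encard_le_encard h).trans ?_
  refine (Set.encard_insert_le _ _).trans ?_
  have := Set.encard_insert_le {((i, .lower) : Edge)} (i, .upper)
  rw [Set.encard_singleton] at this
  calc _ ≤ (1 + 1 + 1 : ℕ∞) := by gcongr
    _ = _ := by norm_num

theorem exists_norm_le_of_kind {P : EdgeKind → Type*} [∀ k, NormedAddCommGroup (P k)]
    (T : ∀ k, P k) : ∃ C, 0 ≤ C ∧ ∀ k, ‖T k‖ ≤ C := by
  refine ⟨‖T .link‖ + ‖T .upper‖ + ‖T .lower‖, by positivity, fun k => ?_⟩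
  have h1 := norm_nonneg (T .link)
  have h2 := norm_nonneg (T .upper)
  have h3 := norm_nonneg (T .lower)
  cases k <;> linarith

/-- Bounded functionals on the edges of one kind give a bounded operator into `ℓ²(ℤ)`. -/
theorem exists_sampling (L : ℝ) (k : EdgeKind)
    (T : Lp ℂ 2 (edgeMeasure L (0, k)) →L[ℂ] ℂ) :
    ∃ Φ : L2Graph L →L[ℂ] L2Int, ∀ f n, Φ f n = T (f (n, k)) := by
  have hfib : ∀ i : Edge, ((fun n : ℤ => ((n, k) : Edge)) ⁻¹' {i}).encard ≤ (1 : ℕ) := by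
    intro i
    rw [Nat.cast_one, Set.encard_le_one_iff]
    intro a b ha hb
    exact congrArg Prod.fst (Eq.trans (show (a, k) = i from ha) (show (b, k) = i from hb).symm)
  obtain ⟨Φ, h, -⟩ := exists_lp_blockMap (E := fun e : Edge => Lp ℂ 2 (edgeMeasure L e))
    (F := fun _ : ℤ => ℂ) (fun n : ℤ => (n, k)) 1 hfib (fun _ => T) (norm_nonneg T)
    (fun _ => le_rfl)
  exact ⟨Φ, h⟩

/-- Three sequences, one for each kind of edges, combine to an `ℓ²` function on the edges. -/
theorem exists_edge_sequence {H : Type*} [NormedAddCommGroup H] [NormedSpace ℂ H]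
    (P : EdgeKind → H →L[ℂ] L2Int) :
    ∃ A : H →L[ℂ] lp (fun _ : Edge => ℂ) 2, ∀ h n k, A h (n, k) = P k h n := by
  classical
  have hemb : ∀ k : EdgeKind, ∃ Φ : L2Int →L[ℂ] lp (fun _ : Edge => ℂ) 2,
      ∀ x e, Φ x e = if e.2 = k then x e.1 else 0 := by
    intro k
    obtain ⟨Φ, h, -⟩ := exists_lp_blockMap (E := fun _ : ℤ => ℂ) (F := fun _ : Edge => ℂ)
      Prod.fst 3 encard_kind_fiber_le
      (fun e => if e.2 = k then ContinuousLinearMap.id ℂ ℂ else 0) zero_le_one (fun e => by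
        split_ifs
        · exact ContinuousLinearMap.norm_id_le
        · rw [norm_zero]; exact zero_le_one)
    refine ⟨Φ, fun x e => ?_⟩
    rw [h]
    split_ifs <;> simp
  choose Φ hΦ using hemb
  refine ⟨(Φ .link).comp (P .link) + (Φ .upper).comp (P .upper) + (Φ .lower).comp (P .lower),
    fun h n k => ?_⟩
  simp only [add_apply, ContinuousLinearMap.comp_apply, lp.coeFn_add, Pi.add_apply, hΦ]
  cases k <;> simp

theorem encard_id_fiber_le (i : Edge) : ((id : Edge → Edge) ⁻¹' {i}).encard ≤ (1 : ℕ) := by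
  simp

/-- Bounded operators which build functions on the graph from the data `a`, `b`, `f`. -/
theorem exists_graph_synthesis (L : ℝ) (ω : ℂ) {φ ψ : ℝ → ℂ} (hφ : Continuous φ)
    (hψ : Continuous ψ) :
    ∃ (S T : lp (fun _ : Edge => ℂ) 2 →L[ℂ] L2Graph L) (K : L2Graph L →L[ℂ] L2Graph L),
      ∀ a b f e, (S a + T b + K f : L2Graph L) e =ᵐ[edgeMeasure L e]
        fun x => φ x * cosCoef ω (a e) (f e) x + ψ x * sinCoef ω (b e) (f e) x := by
  -- All edges of one kind have the same length, so only three blocks occur and their norms are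
  -- uniformly bounded.
  choose S T K h using fun k : EdgeKind =>
    exists_edge_synthesis (edgeLength L (0, k)) ω hφ hψ
  obtain ⟨CS, hS0, hS⟩ := exists_norm_le_of_kind S
  obtain ⟨CT, hT0, hT⟩ := exists_norm_le_of_kind T
  obtain ⟨CK, hK0, hK⟩ := exists_norm_le_of_kind K
  obtain ⟨S', hS', -⟩ := exists_lp_blockMap (E := fun _ : Edge => ℂ)
    (F := fun e : Edge => Lp ℂ 2 (edgeMeasure L e)) id 1 encard_id_fiber_le
    (fun e => S e.2) hS0 (fun e => hS e.2)
  obtain ⟨T', hT', -⟩ := exists_lp_blockMap (E := fun _ : Edge => ℂ)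
    (F := fun e : Edge => Lp ℂ 2 (edgeMeasure L e)) id 1 encard_id_fiber_le
    (fun e => T e.2) hT0 (fun e => hT e.2)
  obtain ⟨K', hK', -⟩ := exists_lp_blockMap (E := fun e : Edge => Lp ℂ 2 (edgeMeasure L e))
    (F := fun e : Edge => Lp ℂ 2 (edgeMeasure L e)) id 1 encard_id_fiber_le
    (fun e => K e.2) hK0 (fun e => hK e.2)
  refine ⟨S', T', K', fun a b f e => ?_⟩
  have h1 : (S' a + T' b + K' f : L2Graph L) e = S e.2 (a e) + T e.2 (b e) + K e.2 (f e) := by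
    rw [lp.coeFn_add, lp.coeFn_add, Pi.add_apply, Pi.add_apply, hS', hT', hK']
    rfl
  rw [h1]
  exact h e.2 (a e) (b e) (f e)

/-- Cauchy data that satisfy the vertex conditions give functions in the domain of the Laplacian,
depending continuously on the data. -/
theorem exists_solution_operator (L : ℝ) (ω : ℂ) :
    ∃ (S T : lp (fun _ : Edge => ℂ) 2 →L[ℂ] L2Graph L) (K : L2Graph L →L[ℂ] L2Graph L),
      (∀ (a b : lp (fun _ : Edge => ℂ) 2) (f : L2Graph L), VertexConditions L ω f a b →
        HasCauchyData L (S a + T b + K f) (-f - ω ^ 2 • (S a + T b + K f)) a b) ∧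
      ∀ b e, T b e =ᵐ[edgeMeasure L e] fun x => b e * sinSol ω x := by
  obtain ⟨S, T, K, h⟩ := exists_graph_synthesis L ω (continuous_cosSol ω) (continuous_sinSol ω)
  obtain ⟨S', T', K', h'⟩ := exists_graph_synthesis L ω
    (φ := fun x => -(ω ^ 2 * sinSol ω x)) (ψ := cosSol ω) (by fun_prop) (by fun_prop)
  refine ⟨S, T, K, fun a b f hvc => ?_, fun b e => ?_⟩
  · have key := fun e => isACRep_cauchySol (h a b f e) (h' a b f e)
    refine ⟨S' a + T' b + K' f, fun e => cauchySol ω (a e) (b e) (f e),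
      fun e => cauchySolDeriv ω (a e) (b e) (f e), fun e => (key e).1, fun e => (key e).2,
      ⟨fun n => ?_, fun n => ?_, fun n => ?_, fun n => ?_⟩, ⟨fun n => ?_, fun n => ?_⟩,
      fun e => cauchySol_zero _ _ _ _, fun e => cauchySolDeriv_zero _ _ _ _⟩
    · rw [cauchySol_zero]; exact hvc.left_upper n
    · rw [cauchySol_zero]; exact hvc.left_lower n
    · rw [cauchySol_zero]; exact hvc.right_upper n
    · rw [cauchySol_zero]; exact hvc.right_lower n
    · rw [cauchySolDeriv_zero, cauchySolDeriv_zero]; exact hvc.kirchhoff_left n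
    · rw [cauchySolDeriv_zero]; exact hvc.kirchhoff_right n
  · have h1 := h 0 b 0 e
    simp only [map_zero, zero_add, add_zero] at h1
    filter_upwards [h1, ae_restrict_mem measurableSet_Icc] with x hx hxI
    have i : ∀ θ : ℝ → ℂ,
        ∫ t in (0 : ℝ)..x, θ t * ((0 : L2Graph L) e : Lp ℂ 2 (edgeMeasure L e)) t = 0 := by
      intro θ
      rw [integral_congr_Lp (g := fun _ => 0) hxI, intervalIntegral.integral_zero]
      filter_upwards [Lp.coeFn_zero ℂ 2 (edgeMeasure L e)] with t ht
      change θ t * (0 : Lp ℂ 2 (edgeMeasure L e)) t = 0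
      rw [ht, Pi.zero_apply, mul_zero]
    rw [hx, cosCoef, sinCoef, i, i]
    simp [mul_comm]

/-! ### The monodromy recursion. -/

/-- The integral of `sinSol ω * f` over an edge. -/
noncomputable def sinMoment (L : ℝ) (ω : ℂ) (f : L2Graph L) (e : Edge) : ℂ :=
  ∫ t in (0 : ℝ)..edgeLength L e, sinSol ω t * f e t

/-- The integral of `cosSol ω * f` over an edge. -/
noncomputable def cosMoment (L : ℝ) (ω : ℂ) (f : L2Graph L) (e : Edge) : ℂ :=
  ∫ t in (0 : ℝ)..edgeLength L e, cosSol ω t * f e t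

theorem rightValue_eq (L : ℝ) (ω : ℂ) (f : L2Graph L) (a b : Edge → ℂ) (e : Edge) :
    rightValue L ω f a b e = cosSol ω (edgeLength L e) * (a e + sinMoment L ω f e)
      + sinSol ω (edgeLength L e) * (b e - cosMoment L ω f e) := rfl

theorem rightDeriv_eq (L : ℝ) (ω : ℂ) (f : L2Graph L) (a b : Edge → ℂ) (e : Edge) :
    rightDeriv L ω f a b e = -(ω ^ 2 * sinSol ω (edgeLength L e)) * (a e + sinMoment L ω f e)
      + cosSol ω (edgeLength L e) * (b e - cosMoment L ω f e) := rfl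

@[simp] theorem edgeLength_link (L : ℝ) (n : ℤ) : edgeLength L (n, .link) = L := rfl

@[simp] theorem edgeLength_upper (L : ℝ) (n : ℤ) : edgeLength L (n, .upper) = Real.pi := rfl

@[simp] theorem edgeLength_lower (L : ℝ) (n : ℤ) : edgeLength L (n, .lower) = Real.pi := rfl

theorem exists_moment_operators {L : ℝ} (hL : 0 < L) (ω : ℂ) (k : EdgeKind) :
    ∃ Φ Ψ : L2Graph L →L[ℂ] L2Int, ∀ f n, Φ f n = sinMoment L ω f (n, k) ∧
      Ψ f n = cosMoment L ω f (n, k) := by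
  have hpos := (edgeLength_pos hL (0, k)).le
  obtain ⟨T₁, h₁⟩ := exists_integral_functional hpos (continuous_sinSol ω)
  obtain ⟨T₂, h₂⟩ := exists_integral_functional hpos (continuous_cosSol ω)
  obtain ⟨Φ, hΦ⟩ := exists_sampling L k T₁
  obtain ⟨Ψ, hΨ⟩ := exists_sampling L k T₂
  exact ⟨Φ, Ψ, fun f n => ⟨(hΦ f n).trans (h₁ _), (hΨ f n).trans (h₂ _)⟩⟩

/-- First entry of the monodromy matrix, which maps the Cauchy data at the left end of a link to those
at the left end of the next link. -/
noncomputable def monodromy₁₁ (L : ℝ) (ω : ℂ) : ℂ :=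
  cosSol ω Real.pi * cosSol ω L - ω ^ 2 * sinSol ω Real.pi * sinSol ω L / 2

/-- Second entry of the monodromy matrix, see `monodromy₁₁`. -/
noncomputable def monodromy₁₂ (L : ℝ) (ω : ℂ) : ℂ :=
  cosSol ω Real.pi * sinSol ω L + sinSol ω Real.pi * cosSol ω L / 2

/-- Third entry of the monodromy matrix, see `monodromy₁₁`. -/
noncomputable def monodromy₂₁ (L : ℝ) (ω : ℂ) : ℂ :=
  -2 * ω ^ 2 * sinSol ω Real.pi * cosSol ω L - ω ^ 2 * cosSol ω Real.pi * sinSol ω L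

/-- Fourth entry of the monodromy matrix, see `monodromy₁₁`. -/
noncomputable def monodromy₂₂ (L : ℝ) (ω : ℂ) : ℂ :=
  -2 * ω ^ 2 * sinSol ω Real.pi * sinSol ω L + cosSol ω Real.pi * cosSol ω L

/-- `M` is the transfer matrix of the link followed by that of the circle, and `cosSol_sq_add` gives
each of them determinant one. -/
theorem monodromy_det (L : ℝ) (ω : ℂ) :
    monodromy₁₁ L ω * monodromy₂₂ L ω - monodromy₁₂ L ω * monodromy₂₁ L ω = 1 := by
  have h1 := cosSol_sq_add ω Real.pi
  have h2 := cosSol_sq_add ω L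
  simp only [monodromy₁₁, monodromy₁₂, monodromy₂₁, monodromy₂₂]
  linear_combination (cosSol ω L ^ 2 + ω ^ 2 * sinSol ω L ^ 2) * h1 + h2

theorem monodromy_trace (L : ℝ) (ω : ℂ) :
    monodromy₁₁ L ω + monodromy₂₂ L ω = complexDiscriminant L ω := by
  rw [complexDiscriminant, mul_comm (Real.pi : ℂ) ω, mul_comm (L : ℂ) ω, ← mul_sinSol,
    ← mul_sinSol]
  simp only [monodromy₁₁, monodromy₂₂, cosSol]
  ring

/-- The inhomogeneity in the recursion for the values at the left ends of the links. -/
noncomputable def forcing₁ (L : ℝ) (ω : ℂ) (f : L2Graph L) (n : ℤ) : ℂ :=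
  monodromy₁₁ L ω * sinMoment L ω f (n, .link) - monodromy₁₂ L ω * cosMoment L ω f (n, .link)
    + cosSol ω Real.pi / 2 * (sinMoment L ω f (n, .upper) + sinMoment L ω f (n, .lower))
    - sinSol ω Real.pi / 2 * (cosMoment L ω f (n, .upper) + cosMoment L ω f (n, .lower))

/-- The inhomogeneity in the recursion for the derivatives at the left ends of the links. -/
noncomputable def forcing₂ (L : ℝ) (ω : ℂ) (f : L2Graph L) (n : ℤ) : ℂ :=
  monodromy₂₁ L ω * sinMoment L ω f (n, .link) - monodromy₂₂ L ω * cosMoment L ω f (n, .link)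
    - ω ^ 2 * sinSol ω Real.pi * (sinMoment L ω f (n, .upper) + sinMoment L ω f (n, .lower))
    - cosSol ω Real.pi * (cosMoment L ω f (n, .upper) + cosMoment L ω f (n, .lower))

/-- Averaging the two value conditions and adding the slopes eliminates the individual slopes on the
semicircles: only their sum enters, and the Kirchhoff condition gives it. -/
theorem VertexConditions.recursion {L : ℝ} {ω : ℂ} {f : L2Graph L} {a b : Edge → ℂ}
    (h : VertexConditions L ω f a b) (n : ℤ) :
    a (n + 1, .link) = monodromy₁₁ L ω * a (n, .link) + monodromy₁₂ L ω * b (n, .link)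
      + forcing₁ L ω f n ∧
    b (n + 1, .link) = monodromy₂₁ L ω * a (n, .link) + monodromy₂₂ L ω * b (n, .link)
      + forcing₂ L ω f n := by
  have h1 := h.left_upper n
  have h2 := h.left_lower n
  have h3 := h.right_upper n
  have h4 := h.right_lower n
  have h5 := h.kirchhoff_left n
  have h6 := h.kirchhoff_right n
  simp only [rightValue_eq, rightDeriv_eq, edgeLength_link, edgeLength_upper, edgeLength_lower]
    at h1 h2 h3 h4 h5 h6
  simp only [forcing₁, forcing₂, monodromy₁₁, monodromy₁₂, monodromy₂₁, monodromy₂₂]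
  constructor
  · linear_combination h3 / 2 + h4 / 2 - cosSol ω Real.pi / 2 * (h1 + h2)
      - sinSol ω Real.pi / 2 * h5
  · linear_combination h6 + ω ^ 2 * sinSol ω Real.pi * (h1 + h2) - cosSol ω Real.pi * h5

/-- The Cauchy data on all edges vanish if they vanish on the links, there is no inhomogeneity and
`sin (π ω) / ω ≠ 0`. -/
theorem VertexConditions.eq_zero {L : ℝ} {ω : ℂ} {a b : Edge → ℂ}
    (h : VertexConditions L ω 0 a b) (hω : sinSol ω Real.pi ≠ 0)
    (ha : ∀ n, a (n, .link) = 0) (hb : ∀ n, b (n, .link) = 0)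
    (hs : ∀ e, sinMoment L ω 0 e = 0) (hc : ∀ e, cosMoment L ω 0 e = 0) : a = 0 ∧ b = 0 := by
  have key : ∀ n, a (n, .upper) = 0 ∧ a (n, .lower) = 0 ∧ b (n, .upper) = 0 ∧
      b (n, .lower) = 0 := by
    intro n
    have h1 := h.left_upper n
    have h2 := h.left_lower n
    have h3 := h.right_upper n
    have h4 := h.right_lower n
    simp only [rightValue_eq, edgeLength_link, edgeLength_upper, edgeLength_lower, hs, hc, ha, hb]
      at h1 h2 h3 h4
    simp only [add_zero, sub_zero, mul_zero] at h1 h2 h3 h4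
    rw [← h1, mul_zero, zero_add] at h3
    rw [← h2, mul_zero, zero_add] at h4
    exact ⟨h1.symm, h2.symm, (mul_eq_zero.1 h3.symm).resolve_left hω,
      (mul_eq_zero.1 h4.symm).resolve_left hω⟩
  constructor <;> funext ⟨n, k⟩ <;> cases k
  exacts [ha n, (key n).1, (key n).2.1, hb n, (key n).2.2.1, (key n).2.2.2]

theorem moment_eq_zero {L : ℝ} (hL : 0 < L) (ω : ℂ) {f : L2Graph L} {e : Edge} (hf : f e = 0) :
    sinMoment L ω f e = 0 ∧ cosMoment L ω f e = 0 := by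
  have i : ∀ θ : ℝ → ℂ, ∫ t in (0 : ℝ)..edgeLength L e, θ t * f e t = 0 := by
    intro θ
    rw [integral_congr_Lp (ℓ := edgeLength L e) (g := fun _ => 0) ⟨(edgeLength_pos hL e).le, le_rfl⟩,
      intervalIntegral.integral_zero]
    rw [hf]
    filter_upwards [Lp.coeFn_zero ℂ 2 (edgeMeasure L e)] with t ht
    rw [ht, Pi.zero_apply, mul_zero]
  exact ⟨i _, i _⟩

theorem sinSol_pi_ne_zero {ω : ℂ} (h : ∀ m : ℕ, 1 ≤ m → ω ^ 2 ≠ (m : ℂ) ^ 2) :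
    sinSol ω Real.pi ≠ 0 := by
  intro h0
  by_cases hω : ω = 0
  · simp [sinSol, hω, Real.pi_ne_zero] at h0
  · have h1 := mul_sinSol ω Real.pi
    rw [h0, mul_zero, eq_comm, Complex.sin_eq_zero_iff] at h1
    obtain ⟨k, hk⟩ := h1
    have hk' : ω = k := mul_right_cancel₀ (Complex.ofReal_ne_zero.2 Real.pi_ne_zero) hk
    have hk0 : k ≠ 0 := by
      rintro rfl
      exact hω (by simpa using hk')
    refine h k.natAbs (Int.natAbs_pos.2 hk0) ?_
    rw [hk', ← Int.cast_natCast, ← Int.cast_pow, ← Int.cast_pow, Int.natAbs_sq]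

/-! ### The resolvent set. -/

/-- Apart from the numbers `m²`, the Laplacian has no eigenvalues. -/
theorem eq_zero_of_isLaplacian {L : ℝ} (hL : 0 < L) {ω : ℂ}
    (h : ∀ m : ℕ, 1 ≤ m → ω ^ 2 ≠ (m : ℂ) ^ 2) {w : L2Graph L}
    (hw : IsLaplacian L w (-(ω ^ 2 • w))) : w = 0 := by
  obtain ⟨a, b, hd⟩ := isLaplacian_iff_exists_hasCauchyData.1 hw
  have hvc := hd.vertexConditions hL (f := 0) (by rw [neg_zero, zero_sub])
  have hm := fun e => moment_eq_zero hL ω (f := 0) (e := e) rfl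
  have hf : ∀ n, forcing₁ L ω 0 n = 0 ∧ forcing₂ L ω 0 n = 0 := by
    intro n
    simp only [forcing₁, forcing₂, (hm _).1, (hm _).2]
    simp
  have hz := eq_zero_of_recursion (monodromy_det L ω) (hd.tendsto hL).1 (hd.tendsto hL).2
    (fun n => by simpa [hf] using (hvc.recursion n).1)
    (fun n => by simpa [hf] using (hvc.recursion n).2)
  obtain ⟨rfl, rfl⟩ := hvc.eq_zero (sinSol_pi_ne_zero h) (congrFun hz.1) (congrFun hz.2)
    (fun e => (hm e).1) (fun e => (hm e).2)
  exact hd.eq_zero rfl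

/-- If `ω²` is not one of the numbers `m²` and the discriminant is not in `[-2, 2]`, the
Laplacian has a resolvent at `ω²`. -/
theorem isResolventPoint_of_discriminant {L : ℝ} (hL : 0 < L) {ω : ℂ}
    (h : ∀ m : ℕ, 1 ≤ m → ω ^ 2 ≠ (m : ℂ) ^ 2)
    (hT : ∀ t ∈ Icc (-2 : ℝ) 2, complexDiscriminant L ω ≠ t) :
    IsResolventPoint (-laplacian L) (ω ^ 2) := by
  have hs := sinSol_pi_ne_zero h
  obtain ⟨S₀, C₀, h₀⟩ := exists_moment_operators hL ω .link
  obtain ⟨S₁, C₁, h₁⟩ := exists_moment_operators hL ω .upper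
  obtain ⟨S₂, C₂, h₂⟩ := exists_moment_operators hL ω .lower
  rw [← monodromy_trace] at hT
  obtain ⟨X, Y, hXY⟩ := exists_recursion_solution (monodromy_det L ω) hT
    (monodromy₁₁ L ω • S₀ - monodromy₁₂ L ω • C₀ + (cosSol ω Real.pi / 2) • (S₁ + S₂)
      - (sinSol ω Real.pi / 2) • (C₁ + C₂))
    (monodromy₂₁ L ω • S₀ - monodromy₂₂ L ω • C₀ - (ω ^ 2 * sinSol ω Real.pi) • (S₁ + S₂)
      - cosSol ω Real.pi • (C₁ + C₂))
  -- `U` and `V` are the value and the derivative at the right end of the link. `D` is the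
  -- difference of the upper and lower slopes there, dictated by equality of the two values at the
  -- far end of the circle; solving for it divides by `sinSol ω π`.
  set U := cosSol ω L • (X + S₀) + sinSol ω L • (Y - C₀) with hU
  set V := (-(ω ^ 2 * sinSol ω L)) • (X + S₀) + cosSol ω L • (Y - C₀) with hV
  set D := C₁ - C₂ + (cosSol ω Real.pi / sinSol ω Real.pi) • (S₂ - S₁) with hD
  obtain ⟨A, hA⟩ := exists_edge_sequence fun k : EdgeKind => match k with
    | .link => X
    | .upper => U
    | .lower => U
  obtain ⟨B, hB⟩ := exists_edge_sequence fun k : EdgeKind => match k with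
    | .link => Y
    | .upper => (1 / 2 : ℂ) • (V + D)
    | .lower => (1 / 2 : ℂ) • (V - D)
  obtain ⟨S, T, K, hSTK, -⟩ := exists_solution_operator L ω
  have hvc : ∀ f, VertexConditions L ω f (A f) (B f) := by
    intro f
    have hdiv : sinSol ω Real.pi * (cosSol ω Real.pi / sinSol ω Real.pi) = cosSol ω Real.pi :=
      mul_div_cancel₀ _ hs
    have e₀ := h₀ f
    have e₁ := h₁ f
    have e₂ := h₂ f
    have eX := fun n => (hXY f n).1
    have eY := fun n => (hXY f n).2
    constructor <;> intro n <;>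
    simp only [rightValue_eq, rightDeriv_eq, edgeLength_link, edgeLength_upper, edgeLength_lower,
      hA, hB, eX, eY, hU, hV, hD, add_apply, sub_apply, smul_apply, lp.coeFn_add, lp.coeFn_sub,
      lp.coeFn_smul, Pi.add_apply, Pi.sub_apply, Pi.smul_apply, smul_eq_mul,
      (e₀ n).1, (e₁ n).1, (e₂ n).1, (e₀ n).2, (e₁ n).2, (e₂ n).2,
      monodromy₁₁, monodromy₁₂, monodromy₂₁, monodromy₂₂]
    · linear_combination (1 / 2) * (sinMoment L ω f (n, .upper) - sinMoment L ω f (n, .lower)) * hdiv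
    · linear_combination (-1 / 2) * (sinMoment L ω f (n, .upper) - sinMoment L ω f (n, .lower)) * hdiv
    · ring
    · ring
  set R := S.comp A + T.comp B + K with hR
  have hlap : ∀ f, IsLaplacian L (R f) (-f - ω ^ 2 • R f) := fun f =>
    isLaplacian_iff_exists_hasCauchyData.2 ⟨_, _, hSTK (A f) (B f) f (hvc f)⟩
  refine ⟨R, fun f => ?_, fun w => ?_⟩
  · obtain ⟨hw, hw'⟩ := exists_laplacian_apply (hlap f)
    refine ⟨hw, ?_⟩
    rw [hw']
    abel
  · have h3 := hlap ((-laplacian L) w - ω ^ 2 • (w : L2Graph L))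
    have h4 := isLaplacian_coe w
    have h5 := (laplacianGraph L).sub_mem (x := (_, _)) (y := (_, _)) h3 h4
    -- `R` is a right inverse, so `R (A - ω²) w - w` solves the homogeneous equation and vanishes
    -- because `ω²` is not an eigenvalue.
    refine sub_eq_zero.1 (eq_zero_of_isLaplacian hL h ?_)
    have h6 : ∀ x y r : L2Graph L, -(ω ^ 2 • (r - y)) =
        -(x - ω ^ 2 • y) - ω ^ 2 • r - -x := by
      intro x y r
      rw [smul_sub]
      abel
    rw [h6 ((-laplacian L) w)]
    exact h5

/-! ### Points of the spectrum in the bands. -/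

theorem eqOn_zero_of_forall_integral_mul_eq_zero {ℓ : ℝ} (hℓ : 0 < ℓ) {θ : ℝ → ℂ}
    (hθ : Continuous θ) (h : ∀ f : Lp ℂ 2 (volume.restrict (Icc (0 : ℝ) ℓ)),
      ∫ t in (0 : ℝ)..ℓ, θ t * f t = 0) : EqOn θ 0 (Icc 0 ℓ) := by
  have hmem : MemLp (fun t => (starRingEnd ℂ) (θ t)) 2 (volume.restrict (Icc 0 ℓ)) :=
    memLp_of_continuousOn (Complex.continuous_conj.comp hθ).continuousOn
  have h1 : inner ℂ hmem.toLp hmem.toLp = 0 := by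
    rw [← h hmem.toLp, L2.inner_def, intervalIntegral.integral_of_le hℓ.le,
      ← integral_Icc_eq_integral_Ioc]
    refine integral_congr_ae ?_
    filter_upwards [hmem.coeFn_toLp] with t ht
    rw [ht, RCLike.inner_apply, Complex.conj_conj, mul_comm]
  have h2 := inner_self_eq_zero.1 h1
  refine Measure.eqOn_Icc_of_ae_eq volume hℓ.ne ?_ hθ.continuousOn continuousOn_const
  have h3 := hmem.coeFn_toLp
  rw [h2] at h3
  filter_upwards [h3, Lp.coeFn_zero ℂ 2 (volume.restrict (Icc (0 : ℝ) ℓ))] with t h4 h5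
  rw [h5, Pi.zero_apply, eq_comm, map_eq_zero] at h4
  exact h4

/-- The two moments are independent functionals: otherwise `p sinSol - q cosSol` would vanish on the
edge, and together with its derivative at the midpoint this forces `p = q = 0`. -/
theorem eq_zero_of_moments {ℓ : ℝ} (hℓ : 0 < ℓ) {ω p q : ℂ}
    (h : ∀ f : Lp ℂ 2 (volume.restrict (Icc (0 : ℝ) ℓ)),
      p * (∫ t in (0 : ℝ)..ℓ, sinSol ω t * f t) = q * ∫ t in (0 : ℝ)..ℓ, cosSol ω t * f t) :
    p = 0 ∧ q = 0 := by
  have hz := eqOn_zero_of_forall_integral_mul_eq_zero hℓ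
    (θ := fun t => p * sinSol ω t - q * cosSol ω t) (by fun_prop) fun f => by
      have hi := intervalIntegrable_of_Lp f (x := ℓ) ⟨hℓ.le, le_rfl⟩
      simp only [sub_mul, mul_assoc]
      rw [intervalIntegral.integral_sub, intervalIntegral.integral_const_mul,
        intervalIntegral.integral_const_mul, h f, sub_self]
      · exact (hi.continuousOn_mul (continuous_sinSol ω).continuousOn).const_mul p
      · exact (hi.continuousOn_mul (continuous_cosSol ω).continuousOn).const_mul q
  have hmid : ℓ / 2 ∈ Ioo 0 ℓ := ⟨by linarith, by linarith⟩
  have h1 : p * sinSol ω (ℓ / 2) - q * cosSol ω (ℓ / 2) = 0 := hz (Ioo_subset_Icc_self hmid)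
  have hd1 : HasDerivAt (fun t => p * sinSol ω t - q * cosSol ω t)
      (p * cosSol ω (ℓ / 2) - q * -(ω ^ 2 * sinSol ω (ℓ / 2))) (ℓ / 2) :=
    ((hasDerivAt_sinSol ω _).const_mul p).sub ((hasDerivAt_cosSol ω _).const_mul q)
  have hd2 : HasDerivAt (fun t => p * sinSol ω t - q * cosSol ω t) 0 (ℓ / 2) := by
    refine (hasDerivAt_const (ℓ / 2) (0 : ℂ)).congr_of_eventuallyEq ?_
    filter_upwards [Ioo_mem_nhds hmid.1 hmid.2] with t ht
    exact hz (Ioo_subset_Icc_self ht)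
  have h2 := hd1.unique hd2
  have h3 := cosSol_sq_add ω (ℓ / 2)
  constructor
  · linear_combination cosSol ω (ℓ / 2) * h2 + ω ^ 2 * sinSol ω (ℓ / 2) * h1 - p * h3
  · linear_combination sinSol ω (ℓ / 2) * h2 - cosSol ω (ℓ / 2) * h1 - q * h3

/-- If the discriminant is in `[-2, 2]`, then `ω²` is in the spectrum. -/
theorem not_isResolventPoint_of_discriminant {L : ℝ} (hL : 0 < L) {ω : ℂ} {t : ℝ}
    (ht : t ∈ Icc (-2) 2) (hT : complexDiscriminant L ω = t) :
    ¬ IsResolventPoint (-laplacian L) (ω ^ 2) := by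
  classical
  -- Surjectivity of `A - ω²` alone is contradicted.
  rintro ⟨R, hR, -⟩
  obtain ⟨p, q, hpq, hob⟩ := exists_linear_form_obstruction (monodromy_det L ω) ht
    ((monodromy_trace L ω).trans hT)
  have hdet := monodromy_det L ω
  have key : ∀ f₀ : Lp ℂ 2 (edgeMeasure L (0, .link)),
      (p * monodromy₁₁ L ω + q * monodromy₂₁ L ω) * (∫ t in (0 : ℝ)..L, sinSol ω t * f₀ t) =
      (p * monodromy₁₂ L ω + q * monodromy₂₂ L ω) * ∫ t in (0 : ℝ)..L, cosSol ω t * f₀ t := by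
    intro f₀
    -- For a source on a single link the forcing is `M` applied to the column of the sine moment and
    -- minus the cosine moment of `f₀`. The obstruction thus holds for all pairs of moments and
    -- yields `(p, q) M = 0`, contradicting `det M = 1`.
    set f : L2Graph L := lp.single 2 ((0, .link) : Edge) f₀ with hf
    have hf0 : ∀ e ≠ (0, .link), f e = 0 := fun e he => lp.single_apply_ne _ _ _ he
    have hf1 : f (0, .link) = f₀ := lp.single_apply_self _ _ _
    obtain ⟨hw, hw'⟩ := hR f
    have hlap := isLaplacian_coe ⟨R f, hw⟩
    obtain ⟨a, b, hd⟩ := isLaplacian_iff_exists_hasCauchyData.1 hlap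
    have hvc := hd.vertexConditions hL (ω := ω) (f := f) (by
      rw [sub_eq_iff_eq_add.1 hw', neg_add, sub_eq_add_neg])
    have hm : ∀ e ≠ (0, .link), sinMoment L ω f e = 0 ∧ cosMoment L ω f e = 0 :=
      fun e he => moment_eq_zero hL ω (hf0 e he)
    have hzero : ∀ n ≠ 0, forcing₁ L ω f n = 0 ∧ forcing₂ L ω f n = 0 := by
      intro n hn
      have h0 := hm (n, .link) (by simp [hn])
      have h1 := hm (n, .upper) (by simp)
      have h2 := hm (n, .lower) (by simp)
      simp [forcing₁, forcing₂, h0.1, h0.2, h1.1, h1.2, h2.1, h2.2]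
    have h := hob _ _ _ _ (hd.tendsto hL).1 (hd.tendsto hL).2
      (fun n => (hvc.recursion n).1) (fun n => (hvc.recursion n).2) hzero
    have h1 := hm (0, .upper) (by simp)
    have h2 := hm (0, .lower) (by simp)
    simp only [forcing₁, forcing₂, h1.1, h1.2, h2.1, h2.2, add_zero, mul_zero, sub_zero] at h
    have e1 : sinMoment L ω f (0, .link) = ∫ t in (0 : ℝ)..L, sinSol ω t * f₀ t := by
      rw [sinMoment, hf1, edgeLength_link]
    have e2 : cosMoment L ω f (0, .link) = ∫ t in (0 : ℝ)..L, cosSol ω t * f₀ t := by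
      rw [cosMoment, hf1, edgeLength_link]
    rw [← e1, ← e2]
    linear_combination h
  obtain ⟨h1, h2⟩ := eq_zero_of_moments hL key
  have hp : p = 0 := by
    linear_combination monodromy₂₂ L ω * h1 - monodromy₂₁ L ω * h2 - p * hdet
  have hq : q = 0 := by
    linear_combination monodromy₁₁ L ω * h2 - monodromy₁₂ L ω * h1 - q * hdet
  exact hpq.elim (fun h => h hp) (fun h => h hq)

/-! ### Eigenvalues. -/

theorem eigenspace_eq_bot {L : ℝ} (hL : 0 < L) {z : ℂ} (h : ∀ m : ℕ, 1 ≤ m → z ≠ (m : ℂ) ^ 2) :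
    eigenspace (-laplacian L) z = ⊥ := by
  obtain ⟨ω, rfl⟩ := IsAlgClosed.exists_pow_nat_eq z two_pos
  rw [Submodule.eq_bot_iff]
  intro w hw
  exact eq_zero_of_isLaplacian hL h (mem_eigenspace_iff.1 hw)

/-- For each `m ≥ 1` there are infinitely many independent eigenfunctions, each of them living on a
single circle. -/
theorem not_finiteDimensional_eigenspace {L : ℝ} (hL : 0 < L) {m : ℕ} (hm : 1 ≤ m) :
    ¬ FiniteDimensional ℂ (eigenspace (-laplacian L) ((m : ℂ) ^ 2)) := by
  classical
  obtain ⟨S, T, K, hSTK, hT⟩ := exists_solution_operator L m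
  -- Zero values and opposite unit slopes on the two halves of circle `n`: the functions
  -- `±sin(mx)/m`. They vanish at both vertices and their derivatives cancel there, so nothing leaks
  -- into the links.
  let b : ℤ → lp (fun _ : Edge => ℂ) 2 := fun n =>
    lp.single 2 ((n, .upper) : Edge) (1 : ℂ) - lp.single 2 ((n, .lower) : Edge) (1 : ℂ)
  have hb : ∀ n e, b n e = (if e = (n, .upper) then 1 else 0) -
      (if e = (n, .lower) then 1 else 0) := by
    intro n e
    simp only [b, lp.coeFn_sub, Pi.sub_apply, lp.coeFn_single, Pi.single_apply]
  have hs : sinSol m Real.pi = 0 := by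
    have hm0 : (m : ℂ) ≠ 0 := by exact_mod_cast (by omega : m ≠ 0)
    have := mul_sinSol m Real.pi
    rw [Complex.sin_nat_mul_pi] at this
    exact (mul_eq_zero.1 this).resolve_left hm0
  have hmom := fun e => moment_eq_zero hL m (f := 0) (e := e) rfl
  have hdata : ∀ n, HasCauchyData L (T (b n)) (-((m : ℂ) ^ 2 • T (b n))) 0 (b n) := by
    intro n
    have hvc : VertexConditions L m 0 (0 : Edge → ℂ) (b n) := by
      constructor <;> intro k <;>
      simp [rightValue_eq, rightDeriv_eq, hmom, hb, hs]
    have h1 : HasCauchyData L (S 0 + T (b n) + K 0)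
        (-0 - (m : ℂ) ^ 2 • (S 0 + T (b n) + K 0)) 0 (b n) := hSTK 0 (b n) 0 hvc
    rwa [map_zero, map_zero, zero_add, add_zero, neg_zero, zero_sub] at h1
  have hmem : ∀ n, T (b n) ∈ eigenspace (-laplacian L) ((m : ℂ) ^ 2) := fun n =>
    mem_eigenspace_iff.2 (isLaplacian_iff_exists_hasCauchyData.2 ⟨_, _, hdata n⟩)
  have hne : ∀ n, T (b n) ≠ 0 := by
    intro n h0
    have h1 := hdata n
    rw [h0] at h1
    have h2 := h1.deriv_eq_zero hL (n, .upper)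
    simp [hb] at h2
  have hzero : ∀ n e, e.1 ≠ n → T (b n) e = 0 := by
    intro n e he
    rw [Lp.eq_zero_iff_ae_eq_zero]
    filter_upwards [hT (b n) e] with x hx
    rw [hx, hb, if_neg (by rintro rfl; exact he rfl), if_neg (by rintro rfl; exact he rfl)]
    simp
  -- Eigenfunctions on different circles have disjoint supports and are therefore orthogonal.
  have hli : LinearIndependent ℂ fun n => T (b n) := by
    refine linearIndependent_of_ne_zero_of_inner_eq_zero hne fun i j hij => ?_
    change inner ℂ (T (b i)) (T (b j)) = 0
    rw [lp.inner_eq_tsum]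
    refine (tsum_congr fun e => ?_).trans tsum_zero
    by_cases he : e.1 = i
    · rw [hzero j e (by rw [he]; exact hij), inner_zero_right]
    · rw [hzero i e he, inner_zero_left]
  have hli' : LinearIndependent ℂ
      fun n => (⟨T (b n), hmem n⟩ : eigenspace (-laplacian L) ((m : ℂ) ^ 2)) :=
    LinearIndependent.of_comp (Submodule.subtype _) hli
  intro hfin
  exact not_finite_iff_infinite.2 (inferInstance : Infinite ℤ) hli'.finite

end PeriodicGraph

/-! ### The proposition. -/

theorem mainTheorem5 (L : ℝ) (hL : 0 < L) :
    -- the eigenvalues of infinite multiplicity are exactly the numbers `m²`, `m = 1, 2, …`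
    (∀ z : ℂ, ¬ FiniteDimensional ℂ
        (PeriodicGraph.eigenspace (-PeriodicGraph.laplacian L) z) ↔
      ∃ m : ℕ, 1 ≤ m ∧ z = (m : ℂ) ^ 2) ∧
    -- the spectral bands `σ k = [a k, b k]`, in increasing order
    ∃ (a b : ℕ → ℝ) (σ : ℕ → Set ℝ),
      (∀ k, σ k = Set.Icc (a k) (b k)) ∧
      (∀ k, a k < b k) ∧
      (∀ k, b k ≤ a (k + 1)) ∧
      -- each band is parametrized by `T(ω) ∈ [-2, 2]`, `ω = √lam`
      (∀ k, Set.BijOn (fun lam : ℝ => PeriodicGraph.discriminant L (Real.sqrt lam)) (σ k)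
        (Set.Icc (-2) 2)) ∧
      -- the bands are determined by the condition `T(ω) ∈ [-2, 2]`, `lam = ω²`
      (⋃ k, σ k) =
        {lam : ℝ | ∃ ω : ℝ, lam = ω ^ 2 ∧ PeriodicGraph.discriminant L ω ∈ Set.Icc (-2) 2} ∧
      -- the spectrum consists of the eigenvalues `m²` and of the bands
      PeriodicGraph.unboundedSpectrum (-PeriodicGraph.laplacian L) =
        {z : ℂ | ∃ m : ℕ, 1 ≤ m ∧ z = (m : ℂ) ^ 2} ∪
          ⋃ k, (fun lam : ℝ => (lam : ℂ)) '' σ k ∧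
      -- the eigenvalues `m²` belong to the bands
      (∀ m : ℕ, 1 ≤ m → (m : ℝ) ^ 2 ∈ ⋃ k, σ k) := by
  obtain ⟨a, b, hab, hba, hbij, hU⟩ := PeriodicGraph.exists_spectral_bands hL
  have hnat : ∀ m : ℕ, (m : ℝ) ^ 2 ∈ ⋃ k, Set.Icc (a k) (b k) := by
    intro m
    rw [hU]
    exact ⟨m, rfl, PeriodicGraph.discriminant_natCast_mem_Icc L m⟩
  have hreal : ∀ ω : ℝ, PeriodicGraph.discriminant L ω ∈ Set.Icc (-2) 2 →
      ¬ PeriodicGraph.IsResolventPoint (-PeriodicGraph.laplacian L) ((ω : ℂ) ^ 2) := fun ω hω =>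
    PeriodicGraph.not_isResolventPoint_of_discriminant hL hω (PeriodicGraph.complexDiscriminant_ofReal L ω)
  refine ⟨fun z => ⟨fun h => ?_, ?_⟩, a, b, fun k => Set.Icc (a k) (b k), fun _ => rfl, hab, hba,
    hbij, hU, ?_, fun m _ => hnat m⟩
  · by_contra hz
    push Not at hz
    refine h ?_
    rw [PeriodicGraph.eigenspace_eq_bot hL hz]
    infer_instance
  · rintro ⟨m, hm, rfl⟩
    exact PeriodicGraph.not_finiteDimensional_eigenspace hL hm
  · ext z
    constructor
    · intro hz
      by_contra hcon
      rw [Set.mem_union, not_or] at hcon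
      obtain ⟨ω, rfl⟩ := IsAlgClosed.exists_pow_nat_eq z two_pos
      refine hz (PeriodicGraph.isResolventPoint_of_discriminant hL (fun m hm h => hcon.1 ⟨m, hm, h⟩) ?_)
      intro t ht hT
      have him := PeriodicGraph.im_eq_zero_of_complexDiscriminant_mem hL ht hT
      obtain ⟨x, rfl⟩ : ∃ x : ℝ, ω = x := ⟨ω.re, Complex.ext rfl him⟩
      rw [PeriodicGraph.complexDiscriminant_ofReal, Complex.ofReal_inj] at hT
      have hx : x ^ 2 ∈ ⋃ k, Set.Icc (a k) (b k) := by
        rw [hU]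
        exact ⟨x, rfl, hT ▸ ht⟩
      obtain ⟨k, hk⟩ := Set.mem_iUnion.1 hx
      exact hcon.2 (Set.mem_iUnion.2 ⟨k, x ^ 2, hk, Complex.ofReal_pow x 2⟩)
    · rintro (⟨m, hm, rfl⟩ | hz)
      -- The `m²` need no separate argument, since `T(m) ∈ [-2,2]`.
      · exact hreal m (PeriodicGraph.discriminant_natCast_mem_Icc L m)
      · obtain ⟨k, lam, hk, rfl⟩ := Set.mem_iUnion.1 hz
        have h1 : lam ∈ ⋃ k, Set.Icc (a k) (b k) := Set.mem_iUnion.2 ⟨k, hk⟩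
        rw [hU] at h1
        obtain ⟨ω, rfl, hω⟩ := h1
        have h2 := hreal ω hω
        rw [← Complex.ofReal_pow] at h2
        exact h2
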